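/- Let $p$ be a prime and let $\mathbb F$ be a perfect field of characteristic $p$. For a restricted Lie algebra $L$ over $\mathbb F$ with $[p]$-mapping $x\mapsto x^{p}$, let $u(L)$ denote its restricted enveloping algebra (the quotient of the universal enveloping algebra of $L$ by the ideal generated by the differences between the $[p]$-th power and the associative $p$-th power of the elements of $L$), let $\gamma_1(L)=L$, $\gamma_{n+1}(L)=[\gamma_n(L),L]$ and $L'=\gamma_2(L)$, and let $L'^p$ be the restricted subalgebra of $L$ generated by all $x^{p}$ with $x\in L'$. Then $L'^p+\gamma_3(L)$ is an ideal of $L$ closed under the $[p]$-mapping, so that $L/(L'^p+\gamma_3(L))$ is a restricted Lie algebra. Theorem. Let $L$ be a finite-dimensional restricted Lie algebra over $\mathbb F$ that is $p$-nilpotent, i.e. there is an integer $k\ge 1$ with $x^{p^k}=0$ for all $x\in L$. If $H$ is any restricted Lie algebra over $\mathbb F$ such that $u(L)\cong u(H)$ as associative $\mathbb F$-algebras, then $$L/(L'^p+\gamma_3(L))\;\cong\; H/(H'^p+\gamma_3(H))$$ as restricted Lie algebras. -/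

import Mathlib

section RestrictedLie

/-- `coeffAdPow F n k x y` is the endomorphism that is the coefficient of `λ ^ k` in
`ad (λ x + y) ^ n = (λ ad x + ad y) ^ n`, a polynomial in `λ` over the ring of linear
endomorphisms of `L`. -/
noncomputable def coeffAdPow (F : Type*) {L : Type*} [Field F] [LieRing L] [LieAlgebra F L]
    (n k : ℕ) (x y : L) : Module.End F L :=
  ((Polynomial.X * Polynomial.C (LieAlgebra.ad F L x : Module.End F L) +
    Polynomial.C (LieAlgebra.ad F L y : Module.End F L)) ^ n).coeff k

/-- Jacobson's term `s_i(x, y)` for `1 ≤ i ≤ p - 1`: the element such that `i s_i(x, y)` is the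
coefficient of `λ ^ (i - 1)` in `ad (λ x + y) ^ (p - 1) (x)`. Whether `ad x` is bracketing with `x`
on the left or on the right does not matter, because `(-1) ^ (p - 1) = 1` in characteristic `p`. -/
noncomputable def jacobsonTerm (p : ℕ) (F : Type*) {L : Type*} [Field F] [LieRing L]
    [LieAlgebra F L] (i : ℕ) (x y : L) : L :=
  (i : F)⁻¹ • coeffAdPow F (p - 1) (i - 1) x y x

/-- A restricted Lie algebra: a Lie algebra `L` over a field `F` (of prime characteristic `p`)
with a `[p]`-mapping. -/
class RestrictedLieAlgebra (p : ℕ) (F : Type*) (L : Type*) [Field F] [LieRing L]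
    [LieAlgebra F L] where
  /-- The `[p]`-mapping. -/
  pMap : L → L
  ad_pow_p : ∀ x : L,
    (LieAlgebra.ad F L x : Module.End F L) ^ p = (LieAlgebra.ad F L (pMap x) : Module.End F L)
  pMap_smul : ∀ (a : F) (x : L), pMap (a • x) = a ^ p • pMap x
  pMap_add : ∀ x y : L,
    pMap (x + y) = pMap x + pMap y + ∑ i ∈ Finset.Icc 1 (p - 1), jacobsonTerm p F i x y

/-- The `[p]`-mapping of a restricted Lie algebra, with explicit parameters. -/
def pMap (p : ℕ) (F : Type*) {L : Type*} [Field F] [LieRing L] [LieAlgebra F L]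
    [RestrictedLieAlgebra p F L] (x : L) : L :=
  RestrictedLieAlgebra.pMap p F x

/-- `L` is `p`-nilpotent: for some positive `k`, `x ^ [p] ^ k = 0` for all `x`. -/
def IsPNilpotent (p : ℕ) (F : Type*) (L : Type*) [Field F] [LieRing L] [LieAlgebra F L]
    [RestrictedLieAlgebra p F L] : Prop :=
  ∃ k : ℕ, 0 < k ∧ ∀ x : L, (pMap p F)^[k] x = 0

/-- An isomorphism of restricted Lie algebras: an isomorphism of Lie algebras that commutes with
the `[p]`-mappings. -/
structure RestrictedLieEquiv (p : ℕ) (F : Type*) (L H : Type*) [Field F]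
    [LieRing L] [LieAlgebra F L] [RestrictedLieAlgebra p F L]
    [LieRing H] [LieAlgebra F H] [RestrictedLieAlgebra p F H] extends L ≃ₗ⁅F⁆ H where
  map_pMap : ∀ x : L, toFun (pMap p F x) = pMap p F (toFun x)

/-- The relation `x ^ [p] ~ x ^ p` on the universal enveloping algebra of `L`. -/
inductive RestrictedEnvelopingRel (p : ℕ) (F : Type*) (L : Type*) [Field F] [LieRing L]
    [LieAlgebra F L] [RestrictedLieAlgebra p F L] :
    UniversalEnvelopingAlgebra F L → UniversalEnvelopingAlgebra F L → Prop
  | pMap_compat (x : L) : RestrictedEnvelopingRel p F L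
      (UniversalEnvelopingAlgebra.ι F (pMap p F x)) (UniversalEnvelopingAlgebra.ι F x ^ p)

/-- The restricted enveloping algebra `u(L)`: the quotient of the universal enveloping algebra by
the two-sided ideal generated by all `x ^ [p] - x ^ p`, `x ∈ L`. -/
abbrev RestrictedEnvelopingAlgebra (p : ℕ) (F : Type*) (L : Type*) [Field F] [LieRing L]
    [LieAlgebra F L] [RestrictedLieAlgebra p F L] : Type _ :=
  RingQuot (RestrictedEnvelopingRel p F L)

/-- The restricted subalgebra of `L` generated by a set `X`: the smallest Lie subalgebra that
contains `X` and is closed under the `[p]`-mapping. -/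
def restrictedSpan (p : ℕ) (F : Type*) {L : Type*} [Field F] [LieRing L] [LieAlgebra F L]
    [RestrictedLieAlgebra p F L] (X : Set L) : LieSubalgebra F L :=
  sInf {K : LieSubalgebra F L | X ⊆ K ∧ ∀ x ∈ K, pMap p F x ∈ K}

/-- The terms of the lower central series, `γ_1(L) = L` and `γ_{n+1}(L) = [L, γ_n(L)]`
(the index in Mathlib starts at `0`). -/
abbrev lieGamma (F : Type*) (L : Type*) [Field F] [LieRing L] [LieAlgebra F L] (n : ℕ) :
    LieIdeal F L :=
  LieModule.lowerCentralSeries F L L (n - 1)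

/-- `L' ^ p`: the restricted subalgebra generated by all `x ^ [p]` with `x ∈ L' = γ_2(L)`. -/
def derivedPow (p : ℕ) (F : Type*) (L : Type*) [Field F] [LieRing L] [LieAlgebra F L]
    [RestrictedLieAlgebra p F L] : LieSubalgebra F L :=
  restrictedSpan p F (pMap p F '' (lieGamma F L 2 : Set L))

section Facts

variable {p : ℕ} {F : Type*} {L : Type*} [Field F] [LieRing L] [LieAlgebra F L]

theorem coeffAdPow_zero (k : ℕ) (x y : L) :
    coeffAdPow F 0 k x y = if k = 0 then 1 else 0 := by
  simp [coeffAdPow, Polynomial.coeff_one]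

theorem coeffAdPow_succ_zero (n : ℕ) (x y z : L) :
    coeffAdPow F (n + 1) 0 x y z = ⁅y, coeffAdPow F n 0 x y z⁆ := by
  simp [coeffAdPow, pow_succ', add_mul, mul_assoc]

theorem coeffAdPow_succ_succ (n k : ℕ) (x y z : L) :
    coeffAdPow F (n + 1) (k + 1) x y z =
      ⁅x, coeffAdPow F n k x y z⁆ + ⁅y, coeffAdPow F n (k + 1) x y z⁆ := by
  simp [coeffAdPow, pow_succ', add_mul, mul_assoc]

theorem coeffAdPow_mem (I : LieIdeal F L) {x y : L} (hy : y ∈ I) (z : L) (n : ℕ) :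
    ∀ k < n, coeffAdPow F n k x y z ∈ I := by
  induction n with
  | zero => intro k hk; omega
  | succ n ih =>
    intro k hk
    cases k with
    | zero => rw [coeffAdPow_succ_zero]; exact lie_mem_left F L I _ _ hy
    | succ k =>
      rw [coeffAdPow_succ_succ]
      exact add_mem (lie_mem_right F L I _ _ (ih k (by omega))) (lie_mem_left F L I _ _ hy)

theorem sum_jacobsonTerm_mem (I : LieIdeal F L) (x : L) {y : L} (hy : y ∈ I) :
    ∑ i ∈ Finset.Icc 1 (p - 1), jacobsonTerm p F i x y ∈ I := by
  refine sum_mem fun i hi => ?_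
  rw [Finset.mem_Icc] at hi
  exact I.smul_mem _ (coeffAdPow_mem I hy _ _ _ (by omega))

theorem coeffAdPow_mk (I : LieIdeal F L) (x y z : L) (n : ℕ) : ∀ k,
    coeffAdPow F n k (LieSubmodule.Quotient.mk (N := I) x) (LieSubmodule.Quotient.mk (N := I) y)
      (LieSubmodule.Quotient.mk (N := I) z) =
    LieSubmodule.Quotient.mk (N := I) (coeffAdPow F n k x y z) := by
  induction n with
  | zero => intro k; rw [coeffAdPow_zero, coeffAdPow_zero]; split_ifs <;> rfl
  | succ n ih =>
    intro k
    cases k with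
    | zero =>
      rw [coeffAdPow_succ_zero, coeffAdPow_succ_zero, ih, LieSubmodule.Quotient.mk_bracket]
    | succ k =>
      rw [coeffAdPow_succ_succ, coeffAdPow_succ_succ, ih, ih,
        ← LieSubmodule.Quotient.mk_bracket, ← LieSubmodule.Quotient.mk_bracket]
      rfl

theorem sum_jacobsonTerm_mk (I : LieIdeal F L) (x y : L) :
    ∑ i ∈ Finset.Icc 1 (p - 1), jacobsonTerm p F i (LieSubmodule.Quotient.mk (N := I) x)
      (LieSubmodule.Quotient.mk (N := I) y) =
    LieSubmodule.Quotient.mk (N := I) (∑ i ∈ Finset.Icc 1 (p - 1), jacobsonTerm p F i x y) := by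
  change _ = LieSubmodule.Quotient.mk' I _
  rw [map_sum]
  refine Finset.sum_congr rfl fun i _ => ?_
  rw [jacobsonTerm, jacobsonTerm, coeffAdPow_mk]
  rfl

theorem ad_pow_mk (I : LieIdeal F L) (x z : L) (n : ℕ) :
    ((LieAlgebra.ad F (L ⧸ I) (LieSubmodule.Quotient.mk (N := I) x) : Module.End F (L ⧸ I)) ^ n)
      (LieSubmodule.Quotient.mk (N := I) z) =
    LieSubmodule.Quotient.mk (N := I) (((LieAlgebra.ad F L x : Module.End F L) ^ n) z) := by
  induction n with
  | zero => rfl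
  | succ n ih =>
    rw [pow_succ', pow_succ', Module.End.mul_apply, Module.End.mul_apply, ih,
      LieAlgebra.ad_apply, LieAlgebra.ad_apply, LieSubmodule.Quotient.mk_bracket]

variable [RestrictedLieAlgebra p F L]

theorem pMap_add_eq (x y : L) :
    pMap p F (x + y) = pMap p F x + pMap p F y +
      ∑ i ∈ Finset.Icc 1 (p - 1), jacobsonTerm p F i x y :=
  RestrictedLieAlgebra.pMap_add x y

theorem mem_restrictedSpan {X : Set L} {x : L} : x ∈ restrictedSpan p F X ↔
    ∀ K : LieSubalgebra F L, (X ⊆ K ∧ ∀ y ∈ K, pMap p F y ∈ K) → x ∈ K := by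
  rw [← SetLike.mem_coe, restrictedSpan, LieSubalgebra.coe_sInf]
  simp only [Set.mem_iInter, Set.mem_ofPred_eq, SetLike.mem_coe]

theorem subset_restrictedSpan (X : Set L) : X ⊆ restrictedSpan p F X := by
  exact fun x hx => mem_restrictedSpan.2 fun K hK => hK.1 hx

theorem pMap_mem_restrictedSpan {X : Set L} {x : L} (hx : x ∈ restrictedSpan p F X) :
    pMap p F x ∈ restrictedSpan p F X := by
  rw [mem_restrictedSpan] at hx ⊢
  exact fun K hK => hK.2 x (hx K hK)

theorem restrictedSpan_le {X : Set L} {K : LieSubalgebra F L} (hX : X ⊆ K)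
    (hK : ∀ x ∈ K, pMap p F x ∈ K) : restrictedSpan p F X ≤ K :=
  sInf_le ⟨hX, hK⟩

/-- The Lie subalgebra of the elements that are central modulo an ideal `I`. -/
def centralMod (I : LieIdeal F L) : LieSubalgebra F L where
  carrier := {s | ∀ y : L, ⁅s, y⁆ ∈ I}
  add_mem' := fun ha hb y => by rw [add_lie]; exact add_mem (ha y) (hb y)
  zero_mem' := fun y => by rw [zero_lie]; exact I.zero_mem
  smul_mem' := fun c a ha y => by rw [smul_lie]; exact I.smul_mem c (ha y)
  lie_mem' := fun {a b} ha _ y => lie_mem_left F L I _ _ (ha b)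

theorem pMap_mem_centralMod (hp : p ≠ 0) (I : LieIdeal F L) {s : L} (hs : s ∈ centralMod I) :
    pMap p F s ∈ centralMod I := by
  intro y
  have h := congrArg (fun f : Module.End F L => f y) (RestrictedLieAlgebra.ad_pow_p (p := p) (F := F) s)
  simp only [LieAlgebra.ad_apply] at h
  change ⁅RestrictedLieAlgebra.pMap p F s, y⁆ ∈ I
  rw [← h]
  obtain ⟨n, rfl⟩ := Nat.exists_eq_succ_of_ne_zero hp
  rw [pow_succ', Module.End.mul_apply]
  exact hs _

theorem lie_mem_gamma_three {s : L} (hp : p ≠ 0) (hs : s ∈ derivedPow p F L) (y : L) :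
    ⁅s, y⁆ ∈ lieGamma F L 3 := by
  refine restrictedSpan_le (K := centralMod (lieGamma F L 3)) ?_
    (fun x hx => pMap_mem_centralMod hp _ hx) hs y
  rintro _ ⟨x, hx, rfl⟩
  refine pMap_mem_centralMod hp _ fun y => ?_
  rw [← lie_skew]
  refine neg_mem ?_
  change _ ∈ LieModule.lowerCentralSeries F L L (1 + 1)
  rw [LieModule.lowerCentralSeries_succ]
  exact LieSubmodule.lie_mem_lie (LieSubmodule.mem_top y) hx

variable (p F L)

/-- The ideal `L' ^ p + γ_3(L)`: the sum of the two subspaces, which is an ideal of `L`. -/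
def derivedPowAddGammaThree [hp : Fact p.Prime] : LieIdeal F L where
  toSubmodule := (derivedPow p F L).toSubmodule ⊔ (lieGamma F L 3).toSubmodule
  lie_mem := by
    intro x m hm
    change m ∈ (derivedPow p F L).toSubmodule ⊔ (lieGamma F L 3).toSubmodule at hm
    change ⁅x, m⁆ ∈ (derivedPow p F L).toSubmodule ⊔ (lieGamma F L 3).toSubmodule
    obtain ⟨a, ha, c, hc, rfl⟩ := Submodule.mem_sup.1 hm
    refine Submodule.mem_sup_right ?_
    rw [lie_add, ← lie_skew]
    exact add_mem (neg_mem (lie_mem_gamma_three hp.out.ne_zero ha x))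
      (lie_mem_right F L (lieGamma F L 3) _ _ hc)

variable {p F L}

theorem pMap_mem_derivedPowAddGammaThree [Fact p.Prime] {m : L}
    (hm : m ∈ derivedPowAddGammaThree p F L) : pMap p F m ∈ derivedPowAddGammaThree p F L := by
  change m ∈ (derivedPow p F L).toSubmodule ⊔ (lieGamma F L 3).toSubmodule at hm
  change _ ∈ (derivedPow p F L).toSubmodule ⊔ (lieGamma F L 3).toSubmodule
  obtain ⟨a, ha, c, hc, rfl⟩ := Submodule.mem_sup.1 hm
  rw [pMap_add_eq]
  refine add_mem (Submodule.mem_sup_left (add_mem ?_ ?_)) (Submodule.mem_sup_right ?_)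
  · exact pMap_mem_restrictedSpan ha
  · exact subset_restrictedSpan _ ⟨c,
      LieModule.antitone_lowerCentralSeries F L L (by norm_num : 2 - 1 ≤ 3 - 1) hc, rfl⟩
  · exact sum_jacobsonTerm_mem _ _ hc

/-- The restricted Lie algebra structure on the quotient by an ideal that is closed under the
`[p]`-mapping: `(x + I) ^ [p] = x ^ [p] + I`. -/
@[reducible] def restrictedLieAlgebraQuotient (I : LieIdeal F L) (hI : ∀ x ∈ I, pMap p F x ∈ I) :
    RestrictedLieAlgebra p F (L ⧸ I) where
  pMap := Quotient.map' (pMap p F) fun a b h => by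
    rw [Submodule.quotientRel_def] at h ⊢
    have hd : b - a ∈ I := by rw [← neg_sub]; exact neg_mem h
    have e := pMap_add_eq (p := p) (F := F) a (b - a)
    rw [add_sub_cancel] at e
    rw [e, ← neg_sub, add_assoc, add_sub_cancel_left]
    exact neg_mem (add_mem (hI _ hd) (sum_jacobsonTerm_mem I a hd))
  ad_pow_p := by
    rintro ⟨x⟩
    refine LinearMap.ext ?_
    rintro ⟨z⟩
    refine (ad_pow_mk I x z p).trans ?_
    rw [RestrictedLieAlgebra.ad_pow_p x]
    rfl
  pMap_smul := by
    rintro a ⟨x⟩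
    exact congrArg (LieSubmodule.Quotient.mk (N := I)) (RestrictedLieAlgebra.pMap_smul a x)
  pMap_add := by
    rintro ⟨x⟩ ⟨y⟩
    refine (congrArg (LieSubmodule.Quotient.mk (N := I)) (pMap_add_eq x y)).trans ?_
    exact congrArg (fun s => LieSubmodule.Quotient.mk (N := I) (pMap p F x) +
      LieSubmodule.Quotient.mk (N := I) (pMap p F y) + s) (sum_jacobsonTerm_mk I x y).symm

/-- The quotient `L / (L' ^ p + γ_3(L))` is a restricted Lie algebra. -/
instance instRestrictedLieAlgebraQuotient [Fact p.Prime] :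
    RestrictedLieAlgebra p F (L ⧸ derivedPowAddGammaThree p F L) :=
  restrictedLieAlgebraQuotient _ fun _ hx => pMap_mem_derivedPowAddGammaThree hx

end Facts

end RestrictedLie

/-! Write M for one of the two quotients. It has class at most two and its `[p]`-mapping kills
brackets. The heart of the proof is `exists_restricted_retraction`: if M is also `p`-nilpotent, it
embeds by a map η into the augmentation ideal of an associative algebra B, with a linear retraction
π that is a Lie homomorphism on B and respects `p`-th powers on the augmentation ideal. For M a
quotient of H, the composite L → u(L) ≅ u(H) → B → M is then a restricted homomorphism. Modulo
brackets and `p`-th powers π is a derivation over the augmentation, so the image of L generates M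
modulo these, and `p`-nilpotence makes it all of M (`exists_surjective_of_augmented`). Exchanging L
and H gives surjections both ways between the quotients, and finite dimension makes them bijective.

To build B, choose a bilinear σ with σ(x,y) - σ(y,x) = [x,y] that vanishes on brackets and `p`-th
powers. The `[p]`-mapping, corrected by σ(x,x) if p = 2, is a nilpotent Frobenius-semilinear map φ.
Over a perfect field M has a basis of φ-chains y, φ(y), φ²(y), ...; sending X_s^(p^j) to φ^j(y_s)
and all other monomials to 0 makes M a retract of a quotient of a polynomial ring. Adding η(σ(πa,
πb)) to the product of this commutative algebra restores the bracket.

As H is not assumed `p`-nilpotent, that property of its quotient is carried over from L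
(`pMap_iterate_eq_zero_of_augmented`), through an embedding of M modulo brackets into a commutative
algebra. The isomorphism respects augmentations because u(L) has only one character. -/

/-! ### Universal property and generation of the restricted enveloping algebra. -/

namespace RestrictedEnvelopingAlgebra

attribute [local instance] LieRing.ofAssociativeRing

variable {p : ℕ} {F : Type*} {L : Type*} [Field F] [LieRing L] [LieAlgebra F L]
  [RestrictedLieAlgebra p F L]

variable (p F L) in
/-- The canonical map of `L` into its restricted enveloping algebra. -/
noncomputable def ι : L →ₗ[F] RestrictedEnvelopingAlgebra p F L :=
  (RingQuot.mkAlgHom F (RestrictedEnvelopingRel p F L)).toLinearMap ∘ₗ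
    (UniversalEnvelopingAlgebra.ι F : L →ₗ⁅F⁆ UniversalEnvelopingAlgebra F L).toLinearMap

theorem ι_lie (x y : L) : ι p F L ⁅x, y⁆ = ι p F L x * ι p F L y - ι p F L y * ι p F L x := by
  have h : UniversalEnvelopingAlgebra.ι F ⁅x, y⁆ = _ :=
    LieHom.map_lie (UniversalEnvelopingAlgebra.ι F) x y
  rw [LieRing.of_associative_ring_bracket] at h
  change RingQuot.mkAlgHom F _ (UniversalEnvelopingAlgebra.ι F ⁅x, y⁆) = _
  rw [h, map_sub, map_mul, map_mul]
  rfl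

theorem ι_pMap (x : L) : ι p F L (pMap p F x) = ι p F L x ^ p := by
  change RingQuot.mkAlgHom F _ (UniversalEnvelopingAlgebra.ι F (pMap p F x)) = _
  rw [RingQuot.mkAlgHom_rel F (RestrictedEnvelopingRel.pMap_compat x), map_pow]
  rfl

theorem ι_pMap_iterate (k : ℕ) (x : L) : ι p F L ((pMap p F)^[k] x) = ι p F L x ^ p ^ k := by
  induction k generalizing x with
  | zero => simp
  | succ k ih => rw [Function.iterate_succ_apply, ih, ι_pMap, ← pow_mul, pow_succ']

theorem exists_lift {A : Type*} [Ring A] [Algebra F A] (f : L →ₗ[F] A)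
    (hlie : ∀ x y, f ⁅x, y⁆ = f x * f y - f y * f x) (hp : ∀ x, f (pMap p F x) = f x ^ p) :
    ∃ g : RestrictedEnvelopingAlgebra p F L →ₐ[F] A, ∀ x, g (ι p F L x) = f x := by
  let f' : L →ₗ⁅F⁆ A := { f with map_lie' := fun {x y} => hlie x y }
  refine ⟨RingQuot.liftAlgHom F ⟨UniversalEnvelopingAlgebra.lift F f', ?_⟩, fun x => ?_⟩
  · rintro _ _ ⟨x⟩
    rw [map_pow, UniversalEnvelopingAlgebra.lift_ι_apply, UniversalEnvelopingAlgebra.lift_ι_apply]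
    exact hp x
  · change RingQuot.liftAlgHom F _ (RingQuot.mkAlgHom F _ _) = _
    rw [RingQuot.liftAlgHom_mkAlgHom_apply]
    exact UniversalEnvelopingAlgebra.lift_ι_apply F f' x

theorem algHom_ext {A : Type*} [Ring A] [Algebra F A]
    {f g : RestrictedEnvelopingAlgebra p F L →ₐ[F] A}
    (h : ∀ x, f (ι p F L x) = g (ι p F L x)) : f = g := by
  refine RingQuot.ringQuot_ext' F _ _ (UniversalEnvelopingAlgebra.hom_ext F ?_)
  ext x
  exact h x

/-- The inclusion of L into the subalgebra it generates lifts to u(L). Followed by the inclusion of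
that subalgebra, the lift fixes L, so it is the identity. -/
theorem adjoin_range_ι : Algebra.adjoin F (Set.range (ι p F L)) = ⊤ := by
  set S := Algebra.adjoin F (Set.range (ι p F L))
  have hS : ∀ x, ι p F L x ∈ S := fun x => Algebra.subset_adjoin ⟨x, rfl⟩
  obtain ⟨g, hg⟩ := exists_lift ((ι p F L).codRestrict S.toSubmodule hS)
    (A := S) (fun x y => Subtype.ext (ι_lie x y)) (fun x => Subtype.ext (ι_pMap x))
  have h : S.val.comp g = AlgHom.id F _ :=
    algHom_ext fun x => congrArg Subtype.val (hg x)
  refine top_le_iff.1 fun a _ => ?_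
  rw [← AlgHom.id_apply (R := F) a, ← h]
  exact (g a).2

theorem induction {P : RestrictedEnvelopingAlgebra p F L → Prop}
    (algebraMap : ∀ c, P (algebraMap F _ c)) (ι : ∀ x, P (ι p F L x))
    (add : ∀ a b, P a → P b → P (a + b)) (mul : ∀ a b, P a → P b → P (a * b)) (a) : P a := by
  have h : a ∈ Algebra.adjoin F (Set.range (RestrictedEnvelopingAlgebra.ι p F L)) := by
    rw [adjoin_range_ι]; trivial
  induction h using Algebra.adjoin_induction with
  | mem x hx => obtain ⟨x, rfl⟩ := hx; exact ι x
  | algebraMap c => exact algebraMap c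
  | add a b _ _ ha hb => exact add a b ha hb
  | mul a b _ _ ha hb => exact mul a b ha hb

end RestrictedEnvelopingAlgebra

/-! ### Deforming a commutative algebra by a cocycle. -/

/-- A cocycle on an augmented commutative algebra by which its multiplication can be deformed. -/
structure TwistCocycle (F B : Type*) [Field F] [CommRing B] [Algebra F B] where
  /-- The augmentation. -/
  ε : B →ₐ[F] F
  /-- The bilinear map that is added to the multiplication. -/
  τ : B →ₗ[F] B →ₗ[F] B
  τ_mul_left : ∀ a b c, τ (a * b) c = ε a • τ b c + ε b • τ a c
  τ_mul_right : ∀ a b c, τ a (b * c) = ε b • τ a c + ε c • τ a b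
  mul_τ : ∀ a b c, a * τ b c = ε a • τ b c
  τ_τ_left : ∀ a b c, τ (τ a b) c = 0
  τ_τ_right : ∀ a b c, τ a (τ b c) = 0
  ε_τ : ∀ a b, ε (τ a b) = 0

namespace TwistCocycle

variable {F B : Type*} [Field F] [CommRing B] [Algebra F B] (T : TwistCocycle F B)

theorem τ_one_left (a : B) : T.τ 1 a = 0 := by
  have h := T.τ_mul_left 1 1 a
  rw [mul_one, map_one T.ε, one_smul] at h
  exact left_eq_add.1 h

theorem τ_one_right (a : B) : T.τ a 1 = 0 := by
  have h := T.τ_mul_right a 1 1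
  rw [mul_one, map_one T.ε, one_smul] at h
  exact left_eq_add.1 h

/-- The algebra `B` with the multiplication `a * b + τ a b`. -/
def Twisted (_ : TwistCocycle F B) : Type _ := B

instance : AddCommGroup T.Twisted := inferInstanceAs (AddCommGroup B)
instance : Module F T.Twisted := inferInstanceAs (Module F B)

/-- The identity map of `B`, as a map to the deformed algebra. -/
def toTwisted : B ≃ₗ[F] T.Twisted := LinearEquiv.refl F B

instance : Mul T.Twisted :=
  ⟨fun a b => T.toTwisted (T.toTwisted.symm a * T.toTwisted.symm b +
    T.τ (T.toTwisted.symm a) (T.toTwisted.symm b))⟩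
instance : One T.Twisted := ⟨T.toTwisted 1⟩

theorem toTwisted_mul (a b : B) :
    T.toTwisted a * T.toTwisted b = T.toTwisted (a * b + T.τ a b) := rfl

theorem toTwisted_one : T.toTwisted 1 = 1 := rfl

/-- Both bracketings expand to abc + ε(a)τ(b,c) + ε(b)τ(a,c) + ε(c)τ(a,b). -/
theorem twisted_mul_assoc (a b c : T.Twisted) : a * b * c = a * (b * c) := by
  obtain ⟨a, rfl⟩ := T.toTwisted.surjective a
  obtain ⟨b, rfl⟩ := T.toTwisted.surjective b
  obtain ⟨c, rfl⟩ := T.toTwisted.surjective c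
  simp only [toTwisted_mul]
  congr 1
  rw [map_add, LinearMap.add_apply, map_add, T.τ_mul_left, T.τ_mul_right, T.τ_τ_left,
    T.τ_τ_right, mul_add, T.mul_τ, add_mul, mul_comm (T.τ a b) c, T.mul_τ, mul_assoc]
  abel

instance : Ring T.Twisted :=
  { (inferInstance : AddCommGroup T.Twisted), (inferInstance : Mul T.Twisted),
    (inferInstance : One T.Twisted) with
    mul_assoc := T.twisted_mul_assoc
    one_mul := fun a => by
      obtain ⟨a, rfl⟩ := T.toTwisted.surjective a
      rw [← toTwisted_one, toTwisted_mul, one_mul, τ_one_left, add_zero]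
    mul_one := fun a => by
      obtain ⟨a, rfl⟩ := T.toTwisted.surjective a
      rw [← toTwisted_one, toTwisted_mul, mul_one, τ_one_right, add_zero]
    left_distrib := fun a b c => by
      obtain ⟨a, rfl⟩ := T.toTwisted.surjective a
      obtain ⟨b, rfl⟩ := T.toTwisted.surjective b
      obtain ⟨c, rfl⟩ := T.toTwisted.surjective c
      rw [← map_add]
      simp only [toTwisted_mul]
      rw [← map_add, mul_add, map_add (T.τ a)]
      congr 1
      abel
    right_distrib := fun a b c => by
      obtain ⟨a, rfl⟩ := T.toTwisted.surjective a
      obtain ⟨b, rfl⟩ := T.toTwisted.surjective b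
      obtain ⟨c, rfl⟩ := T.toTwisted.surjective c
      rw [← map_add]
      simp only [toTwisted_mul]
      rw [← map_add, add_mul, map_add T.τ, LinearMap.add_apply]
      congr 1
      abel
    zero_mul := fun a => by
      obtain ⟨a, rfl⟩ := T.toTwisted.surjective a
      rw [← map_zero T.toTwisted, toTwisted_mul, zero_mul, map_zero, LinearMap.zero_apply,
        add_zero]
    mul_zero := fun a => by
      obtain ⟨a, rfl⟩ := T.toTwisted.surjective a
      rw [← map_zero T.toTwisted, toTwisted_mul, mul_zero, map_zero, add_zero] }

instance : Algebra F T.Twisted := Algebra.ofModule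
  (fun c a b => by
    obtain ⟨a, rfl⟩ := T.toTwisted.surjective a
    obtain ⟨b, rfl⟩ := T.toTwisted.surjective b
    rw [← map_smul, toTwisted_mul, toTwisted_mul, ← map_smul, map_smul, LinearMap.smul_apply,
      smul_mul_assoc, smul_add])
  (fun c a b => by
    obtain ⟨a, rfl⟩ := T.toTwisted.surjective a
    obtain ⟨b, rfl⟩ := T.toTwisted.surjective b
    rw [← map_smul, toTwisted_mul, toTwisted_mul, ← map_smul, map_smul,
      mul_smul_comm, smul_add])

/-- The augmentation of the deformed algebra. -/
def twistedε : T.Twisted →ₐ[F] F :=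
  AlgHom.ofLinearMap (T.ε.toLinearMap ∘ₗ T.toTwisted.symm.toLinearMap) (map_one T.ε) (by
    intro a b
    obtain ⟨a, rfl⟩ := T.toTwisted.surjective a
    obtain ⟨b, rfl⟩ := T.toTwisted.surjective b
    change T.ε (a * b + T.τ a b) = T.ε a * T.ε b
    rw [map_add, T.ε_τ, add_zero, map_mul])

theorem toTwisted_sq (a : B) : T.toTwisted a ^ 2 = T.toTwisted (a ^ 2 + T.τ a a) := by
  rw [pow_two, pow_two, toTwisted_mul]

/-- On the augmentation ideal τ kills products in either variable, and `a` kills the values of τ.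
Only the square retains τ(a,a), which is why p = 2 is special below. -/
theorem toTwisted_pow {a : B} (ha : T.ε a = 0) (n : ℕ) :
    T.toTwisted a ^ (n + 3) = T.toTwisted (a ^ (n + 3)) := by
  induction n with
  | zero =>
    rw [zero_add, pow_succ', toTwisted_sq, toTwisted_mul, mul_add, T.mul_τ, ha, map_add (T.τ a),
      T.τ_τ_right, pow_two, T.τ_mul_right, ha]
    simp only [zero_smul, add_zero]
    rw [← pow_two, ← pow_succ']
  | succ n ih =>
    rw [pow_succ', ih, toTwisted_mul, pow_succ' a (n + 2), T.τ_mul_right, ha, map_pow T.ε, ha]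
    simp only [zero_smul, add_zero, zero_pow (Nat.succ_ne_zero _)]
    rw [← pow_succ', ← pow_succ']

end TwistCocycle

/-! ### Chain bases for nilpotent Frobenius-semilinear maps. -/

section Chains

universe u

variable {F : Type*} {N : Type u} [Field F] [AddCommGroup N] [Module F N]

/-- The images of a family of vectors under the iterates of an additive map. -/
def chain (φ : N →+ N) {S : Type*} (y : S → N) (q : S × ℕ) : N := φ^[q.2] (y q.1)

theorem map_chain (φ : N →+ N) {S : Type*} (y : S → N) (s : S) (j : ℕ) :
    φ (chain φ y (s, j)) = chain φ y (s, j + 1) :=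
  (Function.iterate_succ_apply' φ j (y s)).symm

theorem chain_succ (φ : N →+ N) {S : Type*} (y : S → N) (s : S) (j : ℕ) :
    chain φ y (s, j + 1) = chain φ (fun s => φ (y s)) (s, j) :=
  Function.iterate_succ_apply φ j (y s)

theorem chain_of_le {φ : N →+ N} {S : Type*} {y : S → N} {s : S} {i j : ℕ} (hij : i ≤ j)
    (h : chain φ y (s, i) = 0) : chain φ y (s, j) = 0 := by
  induction j, hij using Nat.le_induction with
  | base => exact h
  | succ j _ ih => rw [← map_chain, ih, map_zero]

/-- A family of vectors such that the nonzero members of the associated chains form a basis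
of `K`, and such that the nonzero images of these members are linearly independent even after a
Frobenius twist of the coefficients. -/
structure IsChainFamily (φ : N →+ N) (K : Submodule F N) {S : Type*} (y : S → N) : Prop where
  span_eq : Submodule.span F (Set.range (chain φ y)) = K
  indep : ∀ c : S × ℕ →₀ F, Finsupp.linearCombination F (chain φ y) c = 0 →
    ∀ q, c q ≠ 0 → chain φ y q = 0
  indep_map : ∀ c : S × ℕ →₀ F, φ (Finsupp.linearCombination F (chain φ y) c) = 0 →
    ∀ q, c q ≠ 0 → φ (chain φ y q) = 0

variable {p : ℕ} [Fact p.Prime] {φ : N →+ N}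

theorem map_linearCombination_frobenius (hφ : ∀ (c : F) x, φ (c • x) = c ^ p • φ x) {ι : Type*} (v : ι → N) (c : ι →₀ F) :
    φ (Finsupp.linearCombination F v c) = Finsupp.linearCombination F (fun i => φ (v i))
      (c.mapRange (· ^ p) (zero_pow (Fact.out : p.Prime).ne_zero)) := by
  rw [Finsupp.linearCombination_apply, Finsupp.linearCombination_apply, map_finsuppSum,
    Finsupp.sum_mapRange_index (h := fun i a => a • φ (v i)) (fun _ => zero_smul _ _)]
  simp only [hφ]

theorem linearCombination_comapDomain_of_notMem_range {ι κ : Type*} {v : κ → N} {e : ι → κ}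
    (c : κ →₀ F) (he : Function.Injective e) (h : ∀ q, q ∉ Set.range e → c q • v q = 0) :
    Finsupp.linearCombination F v c =
      Finsupp.linearCombination F (fun i => v (e i)) (c.comapDomain e he.injOn) := by
  rw [Finsupp.linearCombination_comapDomain, Finsupp.linearCombination_apply, Finsupp.sum]
  exact (Finset.sum_preimage e c.support he.injOn (fun q => c q • v q) fun q _ hq => h q hq).symm

theorem linearCombination_split {S ι : Type*} (v : (S ⊕ ι) × ℕ → N) (c : (S ⊕ ι) × ℕ →₀ F) :
    ∃ (c₁ : S × ℕ →₀ F) (c₂ : ι × ℕ →₀ F), (∀ s j, c (Sum.inl s, j) = c₁ (s, j)) ∧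
      (∀ i j, c (Sum.inr i, j) = c₂ (i, j)) ∧
      Finsupp.linearCombination F v c =
        Finsupp.linearCombination F (fun q : S × ℕ => v (Sum.inl q.1, q.2)) c₁ +
        Finsupp.linearCombination F (fun q : ι × ℕ => v (Sum.inr q.1, q.2)) c₂ := by
  induction c using Finsupp.induction_linear with
  | zero => exact ⟨0, 0, by simp, by simp, by simp⟩
  | add c d hc hd =>
    obtain ⟨c₁, c₂, h₁, h₂, h₃⟩ := hc
    obtain ⟨d₁, d₂, k₁, k₂, k₃⟩ := hd
    refine ⟨c₁ + d₁, c₂ + d₂, by simp [h₁, k₁], by simp [h₂, k₂], ?_⟩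
    rw [map_add, h₃, k₃, map_add, map_add]
    abel
  | single q a =>
    classical
    obtain ⟨s | i, j⟩ := q
    · refine ⟨Finsupp.single (s, j) a, 0, fun t k => ?_, fun t k => ?_, by simp⟩
      · simp [Finsupp.single_apply]
      · simp
    · refine ⟨0, Finsupp.single (i, j) a, fun t k => ?_, fun t k => ?_, by simp⟩
      · simp
      · simp [Finsupp.single_apply]

/-- The image of a subspace under a Frobenius-semilinear map over a perfect field. -/
def frobeniusImage [CharP F p] [PerfectField F] (hφ : ∀ (c : F) x, φ (c • x) = c ^ p • φ x)
    (K : Submodule F N) : Submodule F N where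
  carrier := φ '' K
  add_mem' := by
    rintro _ _ ⟨x, hx, rfl⟩ ⟨y, hy, rfl⟩
    exact ⟨x + y, add_mem hx hy, map_add φ x y⟩
  zero_mem' := ⟨0, K.zero_mem, map_zero φ⟩
  smul_mem' := by
    rintro c _ ⟨x, hx, rfl⟩
    have : PerfectRing F p := PerfectField.toPerfectRing p
    obtain ⟨d, rfl⟩ := surjective_frobenius F p c
    exact ⟨d • x, K.smul_mem d hx, hφ d x⟩

/-- One step of the construction of chains: a family for the image of `K` is lifted to `K` and
completed by a basis of a complement in the kernel. -/
theorem IsChainFamily.exists_lift {K K' : Submodule F N} [CharP F p] [PerfectField F]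
    (hφ : ∀ (c : F) x, φ (c • x) = c ^ p • φ x) (hK : ∀ x ∈ K, φ x ∈ K)
    (hK' : ∀ z, z ∈ K' ↔ ∃ x ∈ K, φ x = z) {S : Type u}
    {y' : S → N} (h : IsChainFamily φ K' y') :
    ∃ (ι : Type u) (y : S ⊕ ι → N), IsChainFamily φ K y := by
  -- Zero is lifted to zero: otherwise a lift could be a nonzero kernel vector over which
  -- independence gives no control.
  have hy' : ∀ s, ∃ x ∈ K, φ x = y' s ∧ (y' s = 0 → x = 0) := by
    intro s
    by_cases h0 : y' s = 0
    · exact ⟨0, K.zero_mem, by rw [map_zero, h0], fun _ => rfl⟩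
    · have : y' s ∈ K' := h.span_eq ▸ Submodule.subset_span ⟨(s, 0), rfl⟩
      obtain ⟨x, hx, e⟩ := (hK' _).1 this
      exact ⟨x, hx, e, fun h1 => absurd h1 h0⟩
  choose g hgK hg hg0 using hy'
  have hchain : ∀ s j, chain φ g (s, j + 1) = chain φ y' (s, j) := fun s j => by
    rw [chain_succ]; simp only [hg]
  have hiter : ∀ x ∈ K, ∀ j, φ^[j] x ∈ K := by
    intro x hx j
    induction j with
    | zero => exact hx
    | succ j ih => rw [Function.iterate_succ_apply']; exact hK _ ih
  -- the kernel of `φ` on `K`, and the part of it that is spanned by the chains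
  let E : Submodule F N :=
    { carrier := {x | x ∈ K ∧ φ x = 0}
      add_mem' := fun hx hy => ⟨add_mem hx.1 hy.1, by rw [map_add, hx.2, hy.2, add_zero]⟩
      zero_mem' := ⟨K.zero_mem, map_zero φ⟩
      smul_mem' := fun c x hx => ⟨K.smul_mem c hx.1, by rw [hφ, hx.2, smul_zero]⟩ }
  let E₀ : Submodule F N :=
    Submodule.span F {x | ∃ q, chain φ g q = x ∧ φ (chain φ g q) = 0}
  have hE₀ : E₀ ≤ E := by
    refine Submodule.span_le.2 ?_
    rintro _ ⟨q, rfl, hq⟩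
    exact ⟨hiter _ (hgK _) _, hq⟩
  -- `C` is a complement in all of `N`; since `E₀ ≤ E`, the modular law makes `E ⊓ C` a complement
  -- of `E₀` in `E`.
  obtain ⟨C, hC⟩ := Submodule.exists_isCompl E₀
  let b := Module.Basis.ofVectorSpace F (E ⊓ C : Submodule F N)
  refine ⟨Module.Basis.ofVectorSpaceIndex F (E ⊓ C : Submodule F N), Sum.elim g (fun i => (b i : N)), ?_⟩
  set y := Sum.elim g (fun i => (b i : N)) with hy
  have hbE : ∀ i, (b i : N) ∈ E := fun i => (Submodule.mem_inf.1 (b i).2).1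
  have hinl : ∀ s j, chain φ y (Sum.inl s, j) = chain φ g (s, j) := fun s j => rfl
  have hinr0 : ∀ i, chain φ y (Sum.inr i, 0) = b i := fun i => rfl
  have hinr : ∀ i j, φ (chain φ y (Sum.inr i, j)) = 0 := by
    intro i j
    rw [map_chain]
    refine chain_of_le (Nat.succ_le_succ (Nat.zero_le j)) ?_
    rw [← map_chain]
    exact (hbE i).2
  have hyK : ∀ q, chain φ y q ∈ K := by
    rintro ⟨s | i, j⟩
    · exact hiter _ (hgK s) _
    · exact hiter _ (hbE i).1 _
  -- φ kills the new chains and carries the lifted ones to the chains of `y'`, raising coefficients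
  -- to the `p`-th power, so independence of the latter applies.
  have hmap : ∀ c : (S ⊕ _) × ℕ →₀ F, φ (Finsupp.linearCombination F (chain φ y) c) = 0 →
      ∀ q, c q ≠ 0 → φ (chain φ y q) = 0 := by
    intro c hc q hq
    obtain ⟨c₁, c₂, h₁, h₂, h₃⟩ := linearCombination_split (chain φ y) c
    obtain ⟨s | i, j⟩ := q
    · have e₂ : φ (Finsupp.linearCombination F
          (fun q : _ × ℕ => chain φ y (Sum.inr q.1, q.2)) c₂) = 0 := by
        rw [map_linearCombination_frobenius hφ]
        simp only [hinr]
        rw [Finsupp.linearCombination_apply]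
        simp
      rw [h₃, map_add, e₂, add_zero, map_linearCombination_frobenius hφ] at hc
      have := h.indep _ ((congrArg (fun v => Finsupp.linearCombination F v _)
        (funext fun q : S × ℕ => ?_)).trans hc) (s, j) (by
          rw [Finsupp.mapRange_apply, ← h₁]; exact pow_ne_zero _ hq)
      · rw [hinl, map_chain, hchain]; exact this
      · change chain φ y' (q.1, q.2) = φ (chain φ y (Sum.inl q.1, q.2))
        rw [hinl, map_chain, hchain]
    · exact hinr i j
  refine ⟨le_antisymm ?_ ?_, ?_, hmap⟩
  · refine Submodule.span_le.2 ?_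
    rintro _ ⟨q, rfl⟩
    exact hyK q
  · -- every element of `K` agrees with a combination of the chains up to the kernel
    set W := Submodule.span F (Set.range (chain φ y)) with hW
    have hWg : ∀ q, chain φ g q ∈ W := fun q => Submodule.subset_span ⟨(Sum.inl q.1, q.2), rfl⟩
    have hEW : E ≤ W := by
      intro x hx
      have hx' : x ∈ E₀ ⊔ C := by rw [hC.sup_eq_top]; trivial
      obtain ⟨a, ha, d, hd, rfl⟩ := Submodule.mem_sup.1 hx'
      have hdE : d ∈ E ⊓ C := ⟨by simpa using sub_mem hx (hE₀ ha), hd⟩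
      refine add_mem ?_ ?_
      · refine Submodule.span_le.2 ?_ ha
        rintro _ ⟨q, rfl, -⟩
        exact hWg q
      · have hle : Submodule.map (E ⊓ C).subtype ⊤ ≤ W := by
          rw [← b.span_eq, Submodule.map_span]
          refine Submodule.span_le.2 ?_
          rintro _ ⟨_, ⟨i, rfl⟩, rfl⟩
          exact Submodule.subset_span ⟨(Sum.inr i, 0), rfl⟩
        exact hle ⟨⟨d, hdE⟩, trivial, rfl⟩
    have hφW : ∀ z ∈ K', ∃ w ∈ W ⊓ K, φ w = z := by
      intro z hz
      have hWK : K' ≤ frobeniusImage hφ (W ⊓ K) := by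
        rw [← h.span_eq]
        refine Submodule.span_le.2 ?_
        rintro _ ⟨q, rfl⟩
        refine ⟨chain φ g q, ⟨hWg q, hiter _ (hgK _) _⟩, ?_⟩
        obtain ⟨s, j⟩ := q
        rw [map_chain, hchain]
      exact hWK hz
    intro x hx
    obtain ⟨w, hw, e⟩ := hφW (φ x) ((hK' _).2 ⟨x, hx, rfl⟩)
    have : x - w ∈ E := ⟨sub_mem hx hw.2, by rw [map_sub, e, sub_self]⟩
    simpa using add_mem (hEW this) hw.1
  · intro c hc q hq
    -- Applying φ to the relation leaves only chain members in the kernel of φ. The lifted part then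
    -- lies in `E₀` and the new part in `C`, so each vanishes separately.
    have hm := hmap c (by rw [hc, map_zero])
    obtain ⟨c₁, c₂, h₁, h₂, h₃⟩ := linearCombination_split (chain φ y) c
    rw [hc] at h₃
    have m₁ : Finsupp.linearCombination F
        (fun q : S × ℕ => chain φ y (Sum.inl q.1, q.2)) c₁ ∈ E₀ := by
      rw [Finsupp.linearCombination_apply]
      refine Submodule.finsuppSum_mem _ _ _ _ fun q hq => E₀.smul_mem _ ?_
      exact Submodule.subset_span ⟨q, rfl, hm (Sum.inl q.1, q.2) (by rw [h₁]; exact hq)⟩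
    have hv₂ : ∀ i j, chain φ y (Sum.inr i, j + 1) = 0 := fun i j => by
      rw [← map_chain]; exact hinr i j
    have e₂ := linearCombination_comapDomain_of_notMem_range
      (v := fun q : _ × ℕ => chain φ y (Sum.inr q.1, q.2)) (e := fun i => (i, 0)) c₂
      (fun _ _ h => (Prod.ext_iff.1 h).1) (by
        rintro ⟨i, _ | j⟩ hq
        · exact absurd ⟨i, rfl⟩ hq
        · change c₂ _ • chain φ y _ = 0
          rw [hv₂, smul_zero])
    have m₂ : Finsupp.linearCombination F
        (fun q : _ × ℕ => chain φ y (Sum.inr q.1, q.2)) c₂ ∈ C := by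
      rw [e₂, Finsupp.linearCombination_apply]
      exact Submodule.finsuppSum_mem _ _ _ _ fun i _ =>
        C.smul_mem _ (Submodule.mem_inf.1 (b i).2).2
    have z₁ : Finsupp.linearCombination F
        (fun q : S × ℕ => chain φ y (Sum.inl q.1, q.2)) c₁ = 0 := by
      refine Submodule.disjoint_def.1 hC.disjoint _ m₁ ?_
      rw [eq_neg_of_add_eq_zero_left h₃.symm]
      exact neg_mem m₂
    rw [z₁, zero_add, e₂] at h₃
    obtain ⟨s | i, j⟩ := q
    · have hg00 : ∀ s, c₁ (s, 0) ≠ 0 → g s = 0 := fun s hs => by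
        refine hg0 s ?_
        rw [← hg s]
        exact hm (Sum.inl s, 0) (by rw [h₁]; exact hs)
      rw [hinl]
      rw [h₁] at hq
      cases j with
      | zero => exact hg00 s hq
      | succ j =>
        rw [hchain]
        have e₁ := linearCombination_comapDomain_of_notMem_range
          (v := fun q : S × ℕ => chain φ y (Sum.inl q.1, q.2)) (e := fun q => (q.1, q.2 + 1)) c₁
          (fun q r h => Prod.ext (Prod.ext_iff.1 h).1 (Nat.succ_injective (Prod.ext_iff.1 h).2))
          (by
            rintro ⟨t, _ | i⟩ hq
            · by_cases h0 : c₁ (t, 0) = 0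
              · rw [h0, zero_smul]
              · change _ • g t = 0
                rw [hg00 t h0, smul_zero]
            · exact absurd ⟨(t, i), rfl⟩ hq)
        rw [z₁] at e₁
        refine h.indep _ ((congrArg (fun v => Finsupp.linearCombination F v _)
          (funext fun q : S × ℕ => ?_)).trans e₁.symm) (s, j) hq
        exact (hchain q.1 q.2).symm
    · cases j with
      | zero =>
        refine absurd ?_ hq
        rw [h₂]
        have hb := b.linearIndependent.map' (E ⊓ C).subtype (Submodule.ker_subtype _)
        exact DFunLike.congr_fun (linearIndependent_iff.1 hb _ h₃.symm) i
      | succ j => exact hv₂ i j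

/-- Induction on the nilpotency exponent: φ(K) is a subspace because the field is perfect, and its
exponent is one smaller. -/
theorem exists_isChainFamily [CharP F p] [PerfectField F]
    (hφ : ∀ (c : F) x, φ (c • x) = c ^ p • φ x) (k : ℕ) :
    ∀ K : Submodule F N, (∀ x ∈ K, φ x ∈ K) → (∀ x ∈ K, φ^[k] x = 0) →
      ∃ (S : Type u) (y : S → N), IsChainFamily φ K y := by
  induction k with
  | zero =>
    intro K _ hK
    refine ⟨PEmpty, PEmpty.elim, ?_, fun c _ q => q.1.elim, fun c _ q => q.1.elim⟩
    rw [Set.range_eq_empty, Submodule.span_empty]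
    exact (eq_bot_iff.2 fun x hx => hK x hx).symm
  | succ k ih =>
    intro K hK hk
    obtain ⟨S, y', h⟩ := ih (frobeniusImage hφ K) (by
      rintro _ ⟨x, hx, rfl⟩; exact ⟨φ x, hK x hx, rfl⟩) (by
      rintro _ ⟨x, hx, rfl⟩; rw [← Function.iterate_succ_apply]; exact hk x hx)
    obtain ⟨ι, y, hy⟩ := h.exists_lift hφ hK (fun z => Iff.rfl)
    exact ⟨_, y, hy⟩

end Chains

/-! ### A commutative algebra that retracts onto a Frobenius module. -/

section FrobeniusRetraction

open MvPolynomial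

universe u v

variable {F : Type u} {N : Type v} [Field F] [AddCommGroup N] [Module F N]
variable (p : ℕ) (φ : N →+ N) {S : Type v} (y : S → N)

open Classical in
/-- The weight of an exponent: `X_s ^ (p ^ j)` has weight `φ ^ j (y_s)`, and all other monomials
have weight zero. -/
noncomputable def chainWeight (a : S →₀ ℕ) : N :=
  if h : ∃ q : S × ℕ, a = Finsupp.single q.1 (p ^ q.2) then chain φ y h.choose else 0

variable (F) in
/-- The linear map that sends `X_s ^ (p ^ j)` to `φ ^ j (y_s)` and all other monomials to zero. -/
noncomputable def chainProj : MvPolynomial S F →ₗ[F] N :=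
  (basisMonomials S F).constr F (chainWeight p φ y)

theorem chainProj_monomial (a : S →₀ ℕ) (c : F) :
    chainProj F p φ y (monomial a c) = c • chainWeight p φ y a := by
  have h : monomial a c = c • basisMonomials S F a := by
    rw [coe_basisMonomials, smul_monomial, smul_eq_mul, mul_one]
  rw [h, map_smul, chainProj, Module.Basis.constr_basis]

theorem chainWeight_eq_zero {a : S →₀ ℕ}
    (h : ∀ s j, a = Finsupp.single s (p ^ j) → chain φ y (s, j) = 0) :
    chainWeight p φ y a = 0 := by
  unfold chainWeight
  split_ifs with h'
  · exact h _ _ h'.choose_spec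
  · rfl

theorem induction_of_constantCoeff_eq_zero {h : MvPolynomial S F} (h0 : constantCoeff h = 0)
    {P : MvPolynomial S F → Prop} (zero : P 0) (add : ∀ a b, P a → P b → P (a + b))
    (mon : ∀ a c, a ≠ 0 → P (monomial a c)) : P h := by
  rw [h.as_sum]
  refine Finset.sum_induction _ P add zero fun a ha => mon a _ ?_
  rintro rfl
  rw [mem_support_iff] at ha
  exact ha h0

variable [hp : Fact p.Prime]

theorem chainWeight_single (s : S) (j : ℕ) :
    chainWeight p φ y (Finsupp.single s (p ^ j)) = chain φ y (s, j) := by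
  have h : ∃ q : S × ℕ, Finsupp.single s (p ^ j) = Finsupp.single q.1 (p ^ q.2) := ⟨(s, j), rfl⟩
  unfold chainWeight
  rw [dif_pos h]
  obtain ⟨h₁, h₂⟩ | ⟨h₁, -⟩ := (Finsupp.single_eq_single_iff _ _ _ _).1 h.choose_spec
  · congr 1
    exact Prod.ext h₁.symm (Nat.pow_right_injective hp.out.two_le h₂).symm
  · exact absurd h₁ (pow_ne_zero _ hp.out.ne_zero)

theorem chainWeight_smul (a : S →₀ ℕ) :
    chainWeight p φ y (p • a) = φ (chainWeight p φ y a) := by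
  by_cases h : ∃ q : S × ℕ, a = Finsupp.single q.1 (p ^ q.2)
  · obtain ⟨⟨s, j⟩, rfl⟩ := h
    rw [Finsupp.smul_single, smul_eq_mul, ← pow_succ', chainWeight_single, chainWeight_single,
      map_chain]
  · rw [chainWeight_eq_zero p φ y (a := a) fun s j e => absurd ⟨(s, j), e⟩ h, map_zero]
    refine chainWeight_eq_zero p φ y fun s j e => ?_
    exfalso
    cases j with
    | zero =>
      have := DFunLike.congr_fun e s
      rw [Finsupp.smul_apply, Finsupp.single_eq_same, pow_zero, smul_eq_mul] at this
      exact hp.out.one_lt.ne' (Nat.eq_one_of_mul_eq_one_right this)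
    | succ j =>
      refine h ⟨(s, j), ?_⟩
      ext t
      have := DFunLike.congr_fun e t
      rw [pow_succ', ← smul_eq_mul, ← Finsupp.smul_single, Finsupp.smul_apply,
        Finsupp.smul_apply] at this
      exact Nat.eq_of_mul_eq_mul_left hp.out.pos this

/-- A product of two nonconstant monomials has degree at least 2, so if it is X_s^(p^j) then j > 0
and its weight is φ of the preceding chain member. -/
theorem chainWeight_add_mem {a b : S →₀ ℕ} (ha : a ≠ 0) (hb : b ≠ 0) :
    chainWeight p φ y (a + b) ∈ Set.range φ := by
  by_cases h : ∃ q : S × ℕ, a + b = Finsupp.single q.1 (p ^ q.2)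
  · obtain ⟨⟨s, j⟩, e⟩ := h
    rw [e, chainWeight_single]
    cases j with
    | zero =>
      exfalso
      have hd := congrArg Finsupp.degree e
      rw [map_add, Finsupp.degree_single, pow_zero] at hd
      have h1 : Finsupp.degree a ≠ 0 := by rwa [Ne, Finsupp.degree_eq_zero_iff]
      have h2 : Finsupp.degree b ≠ 0 := by rwa [Ne, Finsupp.degree_eq_zero_iff]
      omega
    | succ j => exact ⟨_, map_chain φ y s j⟩
  · rw [chainWeight_eq_zero p φ y fun s j e => absurd ⟨(s, j), e⟩ h]
    exact ⟨0, map_zero φ⟩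

/-- A proper multiple of X_s^(p^j) of the form X_t^(p^i) has t = s and i > j, which lies beyond the
end of the chain. -/
theorem chainWeight_single_add {s : S} {j : ℕ} (h : φ (chain φ y (s, j)) = 0) {b : S →₀ ℕ}
    (hb : b ≠ 0) : chainWeight p φ y (Finsupp.single s (p ^ j) + b) = 0 := by
  refine chainWeight_eq_zero p φ y fun t i e => ?_
  have hs := DFunLike.congr_fun e s
  rw [Finsupp.add_apply, Finsupp.single_eq_same] at hs
  have hpj := pow_pos hp.out.pos j
  by_cases hts : t = s
  · subst hts
    rw [Finsupp.single_eq_same] at hs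
    have hlt : j < i := by
      by_contra hij
      have hle := Nat.pow_le_pow_right hp.out.pos (not_lt.1 hij)
      have : p ^ j = p ^ i := by omega
      rw [this, add_eq_left] at e
      exact hb e
    rw [map_chain] at h
    exact chain_of_le hlt h
  · rw [Finsupp.single_eq_of_ne (Ne.symm hts)] at hs
    omega

variable {φ}

theorem chainProj_pow [CharP F p] (hφ : ∀ (c : F) x, φ (c • x) = c ^ p • φ x) (a : MvPolynomial S F) :
    chainProj F p φ y (a ^ p) = φ (chainProj F p φ y a) := by
  induction a using MvPolynomial.induction_on' with
  | monomial a c =>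
    rw [monomial_pow, chainProj_monomial, chainProj_monomial, chainWeight_smul, hφ]
  | add a b ha hb => rw [add_pow_char, map_add, map_add, map_add, ha, hb]

theorem chainProj_mul_mem {a b : MvPolynomial S F} (ha : constantCoeff a = 0)
    (hb : constantCoeff b = 0) :
    chainProj F p φ y (a * b) ∈ Submodule.span F (Set.range φ) := by
  refine induction_of_constantCoeff_eq_zero ha (P := fun a => chainProj F p φ y (a * b) ∈ _) ?_ ?_ ?_
  · rw [zero_mul, map_zero]; exact zero_mem _
  · intro a a' h h'; rw [add_mul, map_add]; exact add_mem h h'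
  intro a c ha
  refine induction_of_constantCoeff_eq_zero hb
    (P := fun b => chainProj F p φ y (monomial a c * b) ∈ _) ?_ ?_ ?_
  · rw [mul_zero, map_zero]; exact zero_mem _
  · intro a a' h h'; rw [mul_add, map_add]; exact add_mem h h'
  intro b d hb
  rw [monomial_mul, chainProj_monomial]
  exact Submodule.smul_mem _ _ (Submodule.subset_span (chainWeight_add_mem p φ y ha hb))

theorem chainProj_one : chainProj F p φ y 1 = 0 := by
  rw [← C_1, ← monomial_zero', chainProj_monomial, one_smul]
  refine chainWeight_eq_zero p φ y fun s j e => ?_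
  have := DFunLike.congr_fun e s
  rw [Finsupp.single_eq_same] at this
  exact absurd this.symm (pow_ne_zero _ hp.out.ne_zero)

variable (F) in
/-- The polynomials that are linear combinations of the `X_s ^ (p ^ j)`. -/
noncomputable def chainPoly : (S × ℕ →₀ F) →ₗ[F] MvPolynomial S F :=
  Finsupp.linearCombination F fun q => monomial (Finsupp.single q.1 (p ^ q.2)) 1

theorem chainProj_chainPoly (c : S × ℕ →₀ F) :
    chainProj F p φ y (chainPoly F p c) = Finsupp.linearCombination F (chain φ y) c := by
  rw [chainPoly, Finsupp.apply_linearCombination]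
  congr 1
  congr 1
  funext q
  rw [Function.comp_apply, chainProj_monomial, one_smul, chainWeight_single]

theorem constantCoeff_chainPoly (c : S × ℕ →₀ F) : constantCoeff (chainPoly F p c) = 0 := by
  induction c using Finsupp.induction_linear with
  | zero => rw [map_zero, map_zero]
  | add c d hc hd => rw [map_add, map_add, hc, hd, add_zero]
  | single q a =>
    classical
    rw [chainPoly, Finsupp.linearCombination_single, smul_monomial, constantCoeff_monomial,
      if_neg]
    rw [Finsupp.single_eq_zero]
    exact pow_ne_zero _ hp.out.ne_zero

theorem chainPoly_pow_mem [CharP F p] (c : S × ℕ →₀ F) :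
    chainPoly F p c ^ p ∈ LinearMap.range (chainPoly F p (S := S)) := by
  induction c using Finsupp.induction_linear with
  | zero => rw [map_zero, zero_pow hp.out.ne_zero]; exact zero_mem _
  | add c d hc hd => rw [map_add, add_pow_char]; exact add_mem hc hd
  | single q a =>
    refine ⟨Finsupp.single (q.1, q.2 + 1) (a ^ p), ?_⟩
    rw [chainPoly, Finsupp.linearCombination_single, Finsupp.linearCombination_single, smul_pow,
      monomial_pow, one_pow, Finsupp.smul_single, smul_eq_mul, pow_succ']

/-- By `indep_map`, each monomial that occurs is at or beyond the end of its chain, so multiplying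
it by a nonconstant monomial gives weight zero. -/
theorem chainProj_chainPoly_mul {K : Submodule F N} (hy : IsChainFamily φ K y)
    {c : S × ℕ →₀ F} (hc : φ (chainProj F p φ y (chainPoly F p c)) = 0) {h : MvPolynomial S F}
    (h0 : constantCoeff h = 0) : chainProj F p φ y (chainPoly F p c * h) = 0 := by
  rw [chainProj_chainPoly] at hc
  have hc' := hy.indep_map c hc
  refine induction_of_constantCoeff_eq_zero h0
    (P := fun h => chainProj F p φ y (chainPoly F p c * h) = 0) ?_ ?_ ?_
  · rw [mul_zero, map_zero]
  · intro a b ha hb; rw [mul_add, map_add, ha, hb, add_zero]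
  intro b d hb
  rw [chainPoly, Finsupp.linearCombination_apply, Finsupp.sum, Finset.sum_mul, map_sum]
  refine Finset.sum_eq_zero fun q hq => ?_
  rw [smul_mul_assoc, monomial_mul, map_smul, chainProj_monomial,
    chainWeight_single_add p φ y (hc' q (Finsupp.mem_support_iff.1 hq)) hb, smul_zero, smul_zero]

variable (F φ) in
/-- The largest ideal in the kernel of the augmentation and of `chainProj`. -/
noncomputable def chainIdeal : Ideal (MvPolynomial S F) where
  carrier := {r | constantCoeff r = 0 ∧ ∀ s, chainProj F p φ y (r * s) = 0}
  add_mem' := fun ha hb => ⟨by rw [map_add, ha.1, hb.1, add_zero], fun s => by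
    rw [add_mul, map_add, ha.2, hb.2, add_zero]⟩
  zero_mem' := ⟨map_zero _, fun s => by rw [zero_mul, map_zero]⟩
  smul_mem' := fun c a ha => ⟨by rw [smul_eq_mul, map_mul, ha.1, mul_zero], fun s => by
    rw [smul_eq_mul, mul_comm c, mul_assoc]; exact ha.2 _⟩

/-- Hence two `chainPoly` lifts of the same vector agree modulo the ideal. This makes the arbitrary
linear section in `exists_frobenius_retraction` compatible with `p`-th powers. -/
theorem chainPoly_mem_chainIdeal {K : Submodule F N} (hy : IsChainFamily φ K y)
    {c : S × ℕ →₀ F} (hc : chainProj F p φ y (chainPoly F p c) = 0) :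
    chainPoly F p c ∈ chainIdeal F p φ y := by
  refine ⟨constantCoeff_chainPoly p c, fun s => ?_⟩
  have h := chainProj_chainPoly_mul p y hy (c := c) (by rw [hc, map_zero])
    (h := s - C (constantCoeff s)) (by rw [map_sub, constantCoeff_C, sub_self])
  rwa [mul_sub, map_sub, mul_comm _ (C _), C_mul', map_smul, hc, smul_zero, sub_zero] at h

theorem chainPoly_mul_mem_chainIdeal {K : Submodule F N} (hy : IsChainFamily φ K y)
    {c : S × ℕ →₀ F} (hc : φ (chainProj F p φ y (chainPoly F p c)) = 0) {h : MvPolynomial S F}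
    (h0 : constantCoeff h = 0) : chainPoly F p c * h ∈ chainIdeal F p φ y := by
  refine ⟨by rw [map_mul, h0, mul_zero], fun s => ?_⟩
  rw [mul_assoc]
  exact chainProj_chainPoly_mul p y hy hc (by rw [map_mul, h0, zero_mul])

/-- A vector space with a nilpotent Frobenius-semilinear map `φ` over a perfect field is a direct
summand of a commutative augmented algebra, such that the projection to it commutes with taking
`p`-th powers. -/
theorem exists_frobenius_retraction [CharP F p] [PerfectField F]
    (hφ : ∀ (c : F) x, φ (c • x) = c ^ p • φ x) (k : ℕ) (hk : ∀ x, φ^[k] x = 0) :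
    ∃ (B : Type (max u v)) (_ : CommRing B) (_ : Algebra F B) (ε : B →ₐ[F] F) (π : B →ₗ[F] N)
      (η : N →ₗ[F] B), π 1 = 0 ∧ (∀ n, π (η n) = n) ∧ (∀ n, ε (η n) = 0) ∧
      (∀ n, η (φ n) = η n ^ p) ∧ (∀ a, π (a ^ p) = φ (π a)) ∧
      (∀ a b, ε a = 0 → ε b = 0 → π (a * b) ∈ Submodule.span F (Set.range φ)) ∧
      (∀ n b, φ n = 0 → η n * b = ε b • η n) := by
  obtain ⟨S, y, hy⟩ := exists_isChainFamily hφ k ⊤ (fun _ _ => trivial) (fun x _ => hk x)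
  let I := chainIdeal F p φ y
  have hsurj : LinearMap.range (Finsupp.linearCombination F (chain φ y)) = ⊤ := by
    rw [Finsupp.range_linearCombination, hy.span_eq]
  obtain ⟨g, hg⟩ := LinearMap.exists_rightInverse_of_surjective _ hsurj
  have hg' : ∀ n, chainProj F p φ y (chainPoly F p (g n)) = n := fun n => by
    rw [chainProj_chainPoly]; exact LinearMap.congr_fun hg n
  let ε : (MvPolynomial S F ⧸ I) →ₐ[F] F :=
    Ideal.Quotient.liftₐ I (aeval fun _ => (0 : F)) fun r hr => by
      rw [aeval_zero']; exact hr.1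
  have hε : ∀ r, ε (Ideal.Quotient.mk I r) = constantCoeff r := fun r => by
    change aeval (fun _ => (0 : F)) r = _
    rw [aeval_zero']; rfl
  let π : (MvPolynomial S F ⧸ I) →ₗ[F] N :=
    (I.restrictScalars F).liftQ (chainProj F p φ y) fun r hr => by
      have := hr.2 1
      rwa [mul_one] at this
  have hπ : ∀ r, π (Ideal.Quotient.mk I r) = chainProj F p φ y r := fun r => rfl
  let η : N →ₗ[F] (MvPolynomial S F ⧸ I) :=
    (Ideal.Quotient.mkₐ F I).toLinearMap ∘ₗ chainPoly F p ∘ₗ g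
  have hη : ∀ n, η n = Ideal.Quotient.mk I (chainPoly F p (g n)) := fun n => rfl
  refine ⟨MvPolynomial S F ⧸ I, inferInstance, inferInstance, ε, π, η, ?_, ?_, ?_, ?_, ?_, ?_, ?_⟩
  · rw [← map_one (Ideal.Quotient.mk I), hπ, chainProj_one]
  · intro n; rw [hη, hπ, hg']
  · intro n; rw [hη, hε, constantCoeff_chainPoly]
  · intro n
    rw [hη, hη, ← map_pow, Ideal.Quotient.eq]
    obtain ⟨c, hc⟩ := chainPoly_pow_mem p (g n)
    rw [← hc, ← map_sub]
    refine chainPoly_mem_chainIdeal p y hy ?_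
    rw [map_sub, map_sub, hc, chainProj_pow p y hφ, hg', hg', sub_self]
  · intro a
    obtain ⟨a, rfl⟩ := Ideal.Quotient.mk_surjective a
    rw [← map_pow, hπ, hπ, chainProj_pow p y hφ]
  · intro a b ha hb
    obtain ⟨a, rfl⟩ := Ideal.Quotient.mk_surjective a
    obtain ⟨b, rfl⟩ := Ideal.Quotient.mk_surjective b
    rw [hε] at ha hb
    rw [← map_mul, hπ]
    exact chainProj_mul_mem p y ha hb
  · intro n b hn
    obtain ⟨b, rfl⟩ := Ideal.Quotient.mk_surjective b
    rw [hη, hε, ← map_mul, Algebra.smul_def, mul_comm (algebraMap F _ _)]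
    change _ = _ * Ideal.Quotient.mk I (C (constantCoeff b))
    rw [← map_mul, Ideal.Quotient.eq, ← mul_sub]
    refine chainPoly_mul_mem_chainIdeal p y hy ?_ ?_
    · rw [hg', hn]
    · rw [map_sub, constantCoeff_C, sub_self]

end FrobeniusRetraction

/-! ### Poincaré–Birkhoff–Witt in the abelian case, by rewriting. -/

section AbelianPBW

open MvPolynomial

universe u v

variable {F : Type u} [Field F] (p : ℕ) {S : Type v} (l : S → S →₀ F)

open Classical in
/-- The normal form of a monomial with respect to the rewriting rules `X_s ^ p → l_s`, where `l_s`
is a linear form. -/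
noncomputable def reduceMonomial (a : S →₀ ℕ) : MvPolynomial S F :=
  -- Each step replaces a factor of degree p by one of degree 1; the condition `2 ≤ p` makes the
  -- degree drop, whence termination.
  if h : ∃ s, p ≤ a s ∧ 2 ≤ p then
    (l h.choose).sum fun t c =>
      c • reduceMonomial (a - Finsupp.single h.choose p + Finsupp.single t 1)
  else monomial a 1
termination_by Finsupp.degree a
decreasing_by
  have h1 := tsub_add_cancel_of_le (Finsupp.single_le_iff.2 h.choose_spec.1)
  have h2 := congrArg Finsupp.degree h1
  rw [map_add, Finsupp.degree_single] at h2
  rw [map_add, Finsupp.degree_single]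
  have := h.choose_spec.2
  omega

theorem reduceMonomial_of_lt {a : S →₀ ℕ} (h : ∀ s, a s < p) :
    reduceMonomial p l a = monomial a 1 := by
  rw [reduceMonomial, dif_neg]
  rintro ⟨s, hs, -⟩
  exact absurd (h s) (not_lt.2 hs)

/-- Confluence: the normal form does not depend on the variable chosen. Rules for distinct variables
act on disjoint factors, so by induction on the degree they can be applied in either order. -/
theorem reduceMonomial_add_single [hp : Fact p.Prime] (n : ℕ) : ∀ (b : S →₀ ℕ) (s : S), Finsupp.degree b = n →
    reduceMonomial p l (b + Finsupp.single s p) =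
      (l s).sum fun t c => c • reduceMonomial p l (b + Finsupp.single t 1) := by
  induction n using Nat.strong_induction_on with
  | _ n ih =>
    intro b s hb
    have h : ∃ t, p ≤ (b + Finsupp.single s p) t ∧ 2 ≤ p :=
      ⟨s, by simp, hp.out.two_le⟩
    rw [reduceMonomial, dif_pos h]
    have hs := h.choose_spec.1
    generalize h.choose = r at hs
    by_cases hrs : r = s
    · subst hrs
      rw [add_tsub_cancel_right]
    · rw [Finsupp.add_apply, Finsupp.single_eq_of_ne hrs, add_zero] at hs
      obtain ⟨b', rfl⟩ : ∃ b', b = b' + Finsupp.single r p :=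
        ⟨b - Finsupp.single r p, (tsub_add_cancel_of_le (Finsupp.single_le_iff.2 hs)).symm⟩
      rw [map_add, Finsupp.degree_single] at hb
      have hlt : ∀ t, Finsupp.degree (b' + Finsupp.single t 1) < n := fun t => by
        rw [map_add, Finsupp.degree_single]
        have := hp.out.two_le
        omega
      have e₁ : ∀ t, b' + Finsupp.single r p + Finsupp.single s p - Finsupp.single r p +
          Finsupp.single t 1 = b' + Finsupp.single t 1 + Finsupp.single s p := fun t => by
        rw [add_right_comm, add_tsub_cancel_right, add_right_comm]
      have e₂ : ∀ t, b' + Finsupp.single r p + Finsupp.single t 1 =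
          b' + Finsupp.single t 1 + Finsupp.single r p := fun t => add_right_comm _ _ _
      simp only [e₁, e₂, ih _ (hlt _) _ _ rfl, Finsupp.smul_sum]
      rw [Finsupp.sum_comm]
      simp only [smul_smul, mul_comm, add_right_comm]

/-- The normal form of a polynomial with respect to the rewriting rules `X_s ^ p → l_s`. -/
noncomputable def reducePoly : MvPolynomial S F →ₗ[F] MvPolynomial S F :=
  (basisMonomials S F).constr F (reduceMonomial p l)

theorem reducePoly_monomial (a : S →₀ ℕ) :
    reducePoly p l (monomial a 1) = reduceMonomial p l a := by
  change reducePoly p l (basisMonomials S F a) = _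
  rw [reducePoly, Module.Basis.constr_basis]

/-- The largest ideal in the kernel of `reducePoly`. -/
noncomputable def reduceIdeal : Ideal (MvPolynomial S F) where
  carrier := {r | ∀ g, reducePoly p l (r * g) = 0}
  add_mem' := fun ha hb s => by rw [add_mul, map_add, ha, hb, add_zero]
  zero_mem' := fun s => by rw [zero_mul, map_zero]
  smul_mem' := fun c a ha s => by rw [smul_eq_mul, mul_comm c, mul_assoc]; exact ha _

theorem linearCombination_X_sub_mem_reduceIdeal [Fact p.Prime] (s : S) :
    Finsupp.linearCombination F X (l s) - X s ^ p ∈ reduceIdeal p l := by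
  intro g
  induction g using MvPolynomial.induction_on' with
  | add a b ha hb => rw [mul_add, map_add, ha, hb, add_zero]
  | monomial a c =>
    have hc : monomial a c = c • monomial a (1 : F) := by
      rw [smul_monomial, smul_eq_mul, mul_one]
    rw [hc, mul_smul_comm, map_smul, sub_mul, map_sub, X_pow_eq_monomial, monomial_mul, mul_one,
      reducePoly_monomial, add_comm, reduceMonomial_add_single p l _ _ _ rfl,
      Finsupp.linearCombination_apply, Finsupp.sum_mul, map_finsuppSum]
    refine smul_eq_zero_of_right _ (sub_eq_zero.2 (Finsupp.sum_congr fun t _ => ?_))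
    rw [smul_mul_assoc, map_smul, X, monomial_mul, mul_one, reducePoly_monomial, add_comm]

theorem reducePoly_linearCombination_X [hp : Fact p.Prime] (c : S →₀ F) :
    reducePoly p l (Finsupp.linearCombination F X c) = Finsupp.linearCombination F X c := by
  rw [Finsupp.apply_linearCombination]
  congr 1
  congr 1
  funext s
  rw [Function.comp_apply, X, reducePoly_monomial, reduceMonomial_of_lt]
  intro t
  refine lt_of_le_of_lt ?_ hp.out.one_lt
  classical
  rw [Finsupp.single_apply]
  split_ifs <;> omega

/-- The Poincaré–Birkhoff–Witt theorem for abelian restricted Lie algebras: a vector space with a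
Frobenius-semilinear map `φ` embeds into a commutative algebra, where `φ` becomes the `p`-th
power. -/
theorem exists_injective_frobenius [hp : Fact p.Prime] [CharP F p] {V : Type v} [AddCommGroup V] [Module F V]
    (φ : V →+ V) (hφ : ∀ (c : F) x, φ (c • x) = c ^ p • φ x) :
    ∃ (A : Type (max u v)) (_ : CommRing A) (_ : Algebra F A) (f : V →ₗ[F] A),
      Function.Injective f ∧ (∀ v, f (φ v) = f v ^ p) ∧ ∀ a b : A, (a + b) ^ p = a ^ p + b ^ p := by
  let b := Module.Basis.ofVectorSpace F V
  let l := fun s => b.repr (φ (b s))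
  let I := reduceIdeal p l
  let f : V →ₗ[F] (MvPolynomial _ F ⧸ I) := (Ideal.Quotient.mkₐ F I).toLinearMap ∘ₗ
    Finsupp.linearCombination F X ∘ₗ b.repr.toLinearMap
  have hf : ∀ v, f v = Ideal.Quotient.mk I (Finsupp.linearCombination F X (b.repr v)) :=
    fun v => rfl
  have hadd : ∀ a b : MvPolynomial _ F ⧸ I, (a + b) ^ p = a ^ p + b ^ p := by
    intro x y
    obtain ⟨x, rfl⟩ := Ideal.Quotient.mk_surjective x
    obtain ⟨y, rfl⟩ := Ideal.Quotient.mk_surjective y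
    rw [← map_add, ← map_pow, add_pow_char, map_add, map_pow, map_pow]
  refine ⟨MvPolynomial _ F ⧸ I, inferInstance, inferInstance, f, ?_, ?_, hadd⟩
  · rw [injective_iff_map_eq_zero]
    intro v hv
    rw [hf, Ideal.Quotient.eq_zero_iff_mem] at hv
    -- Linear forms are their own normal forms since 1 < p, so a linear form in the ideal is zero.
    have h := hv 1
    rw [mul_one, reducePoly_linearCombination_X] at h
    have hX : LinearIndependent F (X : _ → MvPolynomial (Module.Basis.ofVectorSpaceIndex F V) F) :=
      (basisMonomials _ F).linearIndependent.comp _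
        (Finsupp.single_left_injective one_ne_zero)
    exact b.repr.map_eq_zero_iff.1 (linearIndependent_iff.1 hX _ h)
  · intro v
    have hv : v ∈ Submodule.span F (Set.range b) := by rw [b.span_eq]; trivial
    induction hv using Submodule.span_induction with
    | zero => rw [map_zero, map_zero, zero_pow hp.out.ne_zero]
    | add v w _ _ hv hw => rw [map_add, map_add, hv, hw, map_add, hadd]
    | smul c v _ hv => rw [hφ, map_smul, hv, map_smul, smul_pow]
    | mem v hv =>
      obtain ⟨s, rfl⟩ := hv
      rw [hf, hf, b.repr_self, Finsupp.linearCombination_single, one_smul, ← map_pow,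
        Ideal.Quotient.eq]
      exact linearCombination_X_sub_mem_reduceIdeal p l s

end AbelianPBW

/-! ### Class two with trivial powers on brackets: the associative retraction. -/

section ClassTwo

universe u v

variable {p : ℕ} {F : Type u} {M : Type v} [Field F] [LieRing M] [LieAlgebra F M]

variable (F M) in
/-- The span of all brackets. -/
def bracketSpan : Submodule F M := Submodule.span F (Set.range fun q : M × M => ⁅q.1, q.2⁆)

theorem lie_mem_bracketSpan (x y : M) : ⁅x, y⁆ ∈ bracketSpan F M :=
  Submodule.subset_span ⟨(x, y), rfl⟩

theorem coeffAdPow_succ_mem_bracketSpan (n k : ℕ) (x y z : M) :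
    coeffAdPow F (n + 1) k x y z ∈ bracketSpan F M := by
  cases k with
  | zero => rw [coeffAdPow_succ_zero]; exact lie_mem_bracketSpan _ _
  | succ k =>
    rw [coeffAdPow_succ_succ]
    exact add_mem (lie_mem_bracketSpan _ _) (lie_mem_bracketSpan _ _)

/-- A triangular decomposition: every alternating bilinear map is of the form
`(v, w) ↦ σ v w - σ w v`. -/
theorem exists_sub_flip_eq {V W : Type*} [AddCommGroup V] [Module F V] [AddCommGroup W]
    [Module F W] (β : V →ₗ[F] V →ₗ[F] W) (hβ : ∀ v, β v v = 0) (Z : Submodule F W)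
    (hZ : ∀ v w, β v w ∈ Z) :
    ∃ σ : V →ₗ[F] V →ₗ[F] W, (∀ v w, σ v w - σ w v = β v w) ∧ ∀ v w, σ v w ∈ Z := by
  let b := Module.Basis.ofVectorSpace F V
  obtain ⟨_, -⟩ := exists_wellFoundedLT (Module.Basis.ofVectorSpaceIndex F V)
  have hskew : ∀ v w, β v w = - β w v := fun v w => by
    have h := hβ (v + w)
    rw [LinearMap.map_add₂, map_add, map_add, hβ, hβ, zero_add, add_zero] at h
    exact eq_neg_of_add_eq_zero_left h
  -- The strictly upper triangular part of β in an ordered basis; no division by 2 is involved.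
  let σ : V →ₗ[F] V →ₗ[F] W :=
    b.constr F fun i => b.constr F fun j => if i < j then β (b i) (b j) else 0
  have hσ : ∀ i j, σ (b i) (b j) = if i < j then β (b i) (b j) else 0 := fun i j => by
    rw [Module.Basis.constr_basis, Module.Basis.constr_basis]
  refine ⟨σ, fun v w => ?_, fun v w => ?_⟩
  · have h : σ - σ.flip = β := by
      refine b.ext fun i => b.ext fun j => ?_
      rw [LinearMap.sub_apply, LinearMap.sub_apply, LinearMap.flip_apply, hσ, hσ]
      rcases lt_trichotomy i j with h | rfl | h
      · rw [if_pos h, if_neg h.not_gt, sub_zero]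
      · rw [if_neg (lt_irrefl _), hβ, sub_zero]
      · rw [if_pos h, if_neg h.not_gt, zero_sub, ← hskew]
    exact congrArg (fun f : V →ₗ[F] V →ₗ[F] W => f v w) h
  · have h : σ.compr₂ Z.mkQ = 0 := by
      refine b.ext fun i => b.ext fun j => ?_
      rw [LinearMap.compr₂_apply, hσ, LinearMap.zero_apply, LinearMap.zero_apply]
      split_ifs
      · exact (Submodule.Quotient.mk_eq_zero Z).2 (hZ _ _)
      · exact map_zero _
    exact (Submodule.Quotient.mk_eq_zero Z).1
      (congrArg (fun f : V →ₗ[F] V →ₗ[F] W ⧸ Z => f v w) h)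

variable [RestrictedLieAlgebra p F M]

variable (p F M) in
/-- A restricted Lie algebra `M` that is nilpotent of class at most two, and whose `[p]`-mapping
vanishes on the derived algebra. -/
structure IsPowerTrivialClassTwo : Prop where
  lie_lie : ∀ x y z : M, ⁅⁅x, y⁆, z⁆ = 0
  pMap_eq_zero : ∀ z ∈ bracketSpan F M, pMap p F z = 0

variable (p F M) in
/-- The span of all brackets and all `p`-th powers. -/
def frattiniSpan : Submodule F M :=
  bracketSpan F M ⊔ Submodule.span F (Set.range (pMap p F : M → M))

theorem pMap_mem_frattiniSpan (x : M) : pMap p F x ∈ frattiniSpan p F M :=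
  Submodule.mem_sup_right (Submodule.subset_span ⟨x, rfl⟩)

theorem bracketSpan_le_frattiniSpan : bracketSpan F M ≤ frattiniSpan p F M := le_sup_left

theorem pMap_smul_eq (c : F) (x : M) : pMap p F (c • x) = c ^ p • pMap p F x :=
  RestrictedLieAlgebra.pMap_smul c x

namespace IsPowerTrivialClassTwo

theorem lie_eq_zero_of_mem_bracketSpan (hM : IsPowerTrivialClassTwo p F M) {z : M}
    (hz : z ∈ bracketSpan F M) (y : M) : ⁅z, y⁆ = 0 := by
  induction hz using Submodule.span_induction with
  | mem z hz => obtain ⟨q, rfl⟩ := hz; exact hM.lie_lie _ _ _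
  | zero => exact zero_lie y
  | add a b _ _ ha hb => rw [add_lie, ha, hb, add_zero]
  | smul c a _ ha => rw [smul_lie, ha, smul_zero]

theorem lie_eq_zero_of_mem_bracketSpan' (hM : IsPowerTrivialClassTwo p F M) {z : M}
    (hz : z ∈ bracketSpan F M) (y : M) : ⁅y, z⁆ = 0 := by
  rw [← lie_skew, hM.lie_eq_zero_of_mem_bracketSpan hz, neg_zero]

variable [hp : Fact p.Prime]

theorem lie_pMap (hM : IsPowerTrivialClassTwo p F M) (x y : M) : ⁅pMap p F x, y⁆ = 0 := by
  have h := congrArg (fun f : Module.End F M => f y)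
    (RestrictedLieAlgebra.ad_pow_p (p := p) (F := F) x)
  change _ = ⁅pMap p F x, y⁆ at h
  rw [← h]
  obtain ⟨n, hn⟩ := Nat.exists_eq_add_of_le hp.out.two_le
  have : p = n + 2 := by omega
  simp only [this, pow_add, Module.End.mul_apply, pow_two, LieAlgebra.ad_apply]
  rw [hM.lie_eq_zero_of_mem_bracketSpan' (lie_mem_bracketSpan x y), map_zero]

theorem lie_eq_zero_of_mem_frattiniSpan (hM : IsPowerTrivialClassTwo p F M) {u : M}
    (hu : u ∈ frattiniSpan p F M) (y : M) : ⁅u, y⁆ = 0 := by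
  obtain ⟨z, hz, w, hw, rfl⟩ := Submodule.mem_sup.1 hu
  rw [add_lie, hM.lie_eq_zero_of_mem_bracketSpan hz, zero_add]
  clear hu
  induction hw using Submodule.span_induction with
  | mem z hz => obtain ⟨q, rfl⟩ := hz; exact hM.lie_pMap _ _
  | zero => exact zero_lie y
  | add a b _ _ ha hb => rw [add_lie, ha, hb, add_zero]
  | smul c a _ ha => rw [smul_lie, ha, smul_zero]

/-- Jacobson's terms are brackets with p - 1 applications of ad. For p > 2 there are at least two,
which give zero in class two; for p = 2 the only term is [y,x]. -/
theorem pMap_add (hM : IsPowerTrivialClassTwo p F M) (x y : M) :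
    pMap p F (x + y) = pMap p F x + pMap p F y + if p = 2 then ⁅y, x⁆ else 0 := by
  rw [pMap_add_eq]
  congr 1
  split_ifs with h2
  · subst h2
    rw [Finset.Icc_self, Finset.sum_singleton, jacobsonTerm, Nat.cast_one, inv_one, one_smul]
    change coeffAdPow F (0 + 1) 0 x y x = _
    rw [coeffAdPow_succ_zero, coeffAdPow_zero, if_pos rfl, Module.End.one_apply]
  · refine Finset.sum_eq_zero fun i _ => ?_
    have h3 : p - 1 = p - 3 + 1 + 1 := by
      have := hp.out.two_le
      omega
    rw [jacobsonTerm, h3]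
    refine smul_eq_zero_of_right _ ?_
    have hc := fun k => coeffAdPow_succ_mem_bracketSpan (F := F) (p - 3) k x y x
    cases i - 1 with
    | zero => rw [coeffAdPow_succ_zero, hM.lie_eq_zero_of_mem_bracketSpan' (hc _)]
    | succ k =>
      rw [coeffAdPow_succ_succ, hM.lie_eq_zero_of_mem_bracketSpan' (hc _),
        hM.lie_eq_zero_of_mem_bracketSpan' (hc _), add_zero]

theorem pMap_add_sub_mem (hM : IsPowerTrivialClassTwo p F M) (x y : M) :
    pMap p F (x + y) - (pMap p F x + pMap p F y) ∈ bracketSpan F M := by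
  rw [hM.pMap_add, add_sub_cancel_left]
  split_ifs
  · exact lie_mem_bracketSpan _ _
  · exact zero_mem _

theorem pMap_add_of_mem (hM : IsPowerTrivialClassTwo p F M) (x : M) {z : M}
    (hz : z ∈ bracketSpan F M) : pMap p F (x + z) = pMap p F x := by
  rw [hM.pMap_add, hM.pMap_eq_zero z hz, hM.lie_eq_zero_of_mem_bracketSpan hz, ite_self,
    add_zero, add_zero]

theorem pMap_eq_of_sub_mem (hM : IsPowerTrivialClassTwo p F M) {x y : M}
    (h : x - y ∈ bracketSpan F M) : pMap p F x = pMap p F y := by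
  rw [← add_sub_cancel y x, hM.pMap_add_of_mem y h]

/-- The span U of brackets and `p`-th powers is central, so the bracket descends to M/U and can be
split there. The vanishing of σ on U later yields the cocycle identities. -/
theorem exists_sigma (hM : IsPowerTrivialClassTwo p F M) : ∃ σ : M →ₗ[F] M →ₗ[F] M,
    (∀ x y, σ x y ∈ bracketSpan F M) ∧ (∀ x y, σ x y - σ y x = ⁅x, y⁆) ∧
    (∀ x ∈ frattiniSpan p F M, ∀ y, σ x y = 0) ∧
    (∀ x ∈ frattiniSpan p F M, ∀ y, σ y x = 0) := by
  set U := frattiniSpan p F M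
  obtain ⟨s, hs⟩ := LinearMap.exists_rightInverse_of_surjective U.mkQ (Submodule.range_mkQ U)
  have hs' : ∀ x, x - s (U.mkQ x) ∈ U := fun x => by
    rw [← Submodule.Quotient.mk_eq_zero, Submodule.Quotient.mk_sub, sub_eq_zero]
    exact (LinearMap.congr_fun hs (U.mkQ x)).symm
  let β : (M ⧸ U) →ₗ[F] (M ⧸ U) →ₗ[F] M :=
    (LieAlgebra.ad F M : M →ₗ[F] M →ₗ[F] M).compl₁₂ s s
  have hβ : ∀ v w, β v w = ⁅s v, s w⁆ := fun _ _ => rfl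
  obtain ⟨σ, h₁, h₂⟩ := exists_sub_flip_eq β (fun v => by rw [hβ, lie_self]) (bracketSpan F M)
    fun v w => by rw [hβ]; exact lie_mem_bracketSpan _ _
  have h0 : ∀ x ∈ U, U.mkQ x = 0 := fun x hx => (Submodule.Quotient.mk_eq_zero U).2 hx
  refine ⟨σ.compl₁₂ U.mkQ U.mkQ, fun x y => h₂ _ _, fun x y => ?_, fun x hx y => ?_,
    fun x hx y => ?_⟩
  · rw [LinearMap.compl₁₂_apply, LinearMap.compl₁₂_apply, h₁, hβ]
    have e₁ := hM.lie_eq_zero_of_mem_frattiniSpan (hs' x) y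
    have e₂ := hM.lie_eq_zero_of_mem_frattiniSpan (hs' y) (s (U.mkQ x))
    rw [sub_lie, sub_eq_zero] at e₁ e₂
    rw [e₁, ← lie_skew, ← e₂, lie_skew]
  · rw [LinearMap.compl₁₂_apply, h0 x hx, map_zero, LinearMap.zero_apply]
  · rw [LinearMap.compl₁₂_apply, h0 x hx, map_zero]

/-- The additive modification of the `[p]`-mapping by a bilinear map that is only needed for
`p = 2`. -/
theorem exists_additive_pMap [CharP F p] (hM : IsPowerTrivialClassTwo p F M)
    {σ : M →ₗ[F] M →ₗ[F] M} (hσ : ∀ x y, σ x y - σ y x = ⁅x, y⁆) :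
    ∃ φ : M →+ M, (∀ x, φ x = pMap p F x - if p = 2 then σ x x else 0) ∧
      ∀ (c : F) x, φ (c • x) = c ^ p • φ x := by
  refine ⟨AddMonoidHom.mk' (fun x => pMap p F x - if p = 2 then σ x x else 0) fun x y => ?_,
    fun x => rfl, fun c x => ?_⟩
  · rw [hM.pMap_add]
    split_ifs with h2
    · subst h2
      -- In characteristic 2 the cross terms σ(x,y) + σ(y,x) equal [y,x], the defect of additivity
      -- of the `[2]`-mapping.
      have hneg : ∀ z : M, -z = z := fun z => by
        rw [neg_eq_iff_add_eq_zero, ← two_smul F z, CharTwo.two_eq_zero, zero_smul]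
      rw [LinearMap.map_add₂, map_add, map_add, ← hσ y x, sub_eq_add_neg (σ y x),
        hneg (σ x y)]
      abel
    · rw [sub_zero, sub_zero, sub_zero, add_zero]
  · change pMap p F (c • x) - _ = c ^ p • (pMap p F x - _)
    rw [pMap_smul_eq, smul_sub]
    split_ifs with h2
    · subst h2
      rw [LinearMap.map_smul₂, map_smul, smul_smul, pow_two]
    · rw [smul_zero]

/-- A `p`-nilpotent restricted Lie algebra over a perfect field that is nilpotent of class at most
two, and whose `[p]`-mapping vanishes on the derived algebra, is a retract of an augmented
associative algebra, where the retraction is a homomorphism of restricted Lie algebras on the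
augmentation ideal. -/
theorem exists_restricted_retraction [CharP F p] [PerfectField F]
    (hM : IsPowerTrivialClassTwo p F M) (k : ℕ) (hk : ∀ x : M, (pMap p F)^[k] x = 0) :
    ∃ (B : Type (max u v)) (_ : Ring B) (_ : Algebra F B) (ε : B →ₐ[F] F) (π : B →ₗ[F] M)
      (η : M →ₗ[F] B), π 1 = 0 ∧ (∀ x, π (η x) = x) ∧ (∀ x, ε (η x) = 0) ∧
      (∀ x y, η ⁅x, y⁆ = η x * η y - η y * η x) ∧ (∀ x, η (pMap p F x) = η x ^ p) ∧
      (∀ a b, π (a * b - b * a) = ⁅π a, π b⁆) ∧ (∀ a, ε a = 0 → π (a ^ p) = pMap p F (π a)) ∧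
      (∀ a b, π (a * b) - (ε a • π b + ε b • π a) ∈ frattiniSpan p F M) := by
  obtain ⟨σ, hσZ, hσ, hσl, hσr⟩ := hM.exists_sigma
  obtain ⟨φ, hφ, hφs⟩ := hM.exists_additive_pMap hσ
  have hφsub : ∀ x, φ x - pMap p F x ∈ bracketSpan F M := fun x => by
    rw [hφ, sub_sub_cancel_left]
    split_ifs
    · exact neg_mem (hσZ _ _)
    · exact neg_mem (zero_mem _)
  have hφZ : ∀ z ∈ bracketSpan F M, φ z = 0 := fun z hz => by
    rw [hφ, hM.pMap_eq_zero z hz, hσl z (bracketSpan_le_frattiniSpan hz), ite_self, sub_zero]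
  have hφU : Submodule.span F (Set.range φ) ≤ frattiniSpan p F M := by
    refine Submodule.span_le.2 ?_
    rintro _ ⟨x, rfl⟩
    rw [← sub_add_cancel (φ x) (pMap p F x)]
    exact add_mem (bracketSpan_le_frattiniSpan (hφsub x)) (pMap_mem_frattiniSpan x)
  have hiter : ∀ j x, φ^[j] x - (pMap p F)^[j] x ∈ bracketSpan F M := by
    intro j x
    induction j with
    | zero => rw [Function.iterate_zero, Function.iterate_zero, sub_self]; exact zero_mem _
    | succ j ih =>
      have h := hφZ _ ih
      rw [map_sub, sub_eq_zero] at h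
      rw [Function.iterate_succ_apply', Function.iterate_succ_apply', h]
      exact hφsub _
  -- The exponent is k + 1 because φ^k agrees with the k-fold `[p]`-mapping only modulo brackets,
  -- which a further φ kills.
  obtain ⟨B, _, _, ε, π, η, hπ1, hπη, hεη, hηφ, hπφ, hπmul, hηmul⟩ :=
    exists_frobenius_retraction p hφs (k + 1) fun x => by
      rw [Function.iterate_succ_apply']
      refine hφZ _ ?_
      have := hiter k x
      rwa [hk, sub_zero] at this
  have hπmul' : ∀ a b, π (a * b) - (ε a • π b + ε b • π a) ∈ frattiniSpan p F M := by
    intro a b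
    have h := hφU (hπmul (a - algebraMap F B (ε a)) (b - algebraMap F B (ε b))
      (by rw [map_sub, AlgHom.commutes, Algebra.algebraMap_self_apply, sub_self])
      (by rw [map_sub, AlgHom.commutes, Algebra.algebraMap_self_apply, sub_self]))
    have e : (a - algebraMap F B (ε a)) * (b - algebraMap F B (ε b)) =
        a * b - (ε a • b + ε b • a) + (ε a * ε b) • (1 : B) := by
      simp only [Algebra.smul_def, map_mul]
      ring
    rwa [e, map_add, map_smul, hπ1, smul_zero, add_zero, map_sub, map_add, map_smul,
      map_smul] at h
  have hσmul : ∀ a b x, σ (π (a * b)) x = ε a • σ (π b) x + ε b • σ (π a) x := fun a b x => by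
    have := hσl _ (hπmul' a b) x
    rwa [LinearMap.map_sub₂, LinearMap.map_add₂, LinearMap.map_smul₂, LinearMap.map_smul₂,
      sub_eq_zero] at this
  have hσmul' : ∀ a b x, σ x (π (a * b)) = ε a • σ x (π b) + ε b • σ x (π a) := fun a b x => by
    have := hσr _ (hπmul' a b) x
    rwa [map_sub, map_add, map_smul, map_smul, sub_eq_zero] at this
  -- The derivation rules hold because σ vanishes on `frattiniSpan`, modulo which π is an
  -- ε-derivation. The augmentation ideal annihilates τ because φ kills brackets.
  let T : TwistCocycle F B :=
    { ε := ε
      τ := (σ.compl₁₂ π π).compr₂ η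
      τ_mul_left := fun a b c => by
        simp only [LinearMap.compr₂_apply, LinearMap.compl₁₂_apply]
        rw [hσmul, map_add, map_smul, map_smul]
      τ_mul_right := fun a b c => by
        simp only [LinearMap.compr₂_apply, LinearMap.compl₁₂_apply]
        rw [hσmul', map_add, map_smul, map_smul]
      mul_τ := fun a b c => by
        simp only [LinearMap.compr₂_apply, LinearMap.compl₁₂_apply]
        rw [mul_comm]
        exact hηmul _ _ (hφZ _ (hσZ _ _))
      τ_τ_left := fun a b c => by
        simp only [LinearMap.compr₂_apply, LinearMap.compl₁₂_apply]
        rw [hπη, hσl _ (bracketSpan_le_frattiniSpan (hσZ _ _)), map_zero]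
      τ_τ_right := fun a b c => by
        simp only [LinearMap.compr₂_apply, LinearMap.compl₁₂_apply]
        rw [hπη, hσr _ (bracketSpan_le_frattiniSpan (hσZ _ _)), map_zero]
      ε_τ := fun a b => hεη _ }
  have hτ : ∀ a b, T.τ a b = η (σ (π a) (π b)) := fun a b => rfl
  -- For p = 2 the extra τ(a,a) gives back the term σ(x,x) that was subtracted from the
  -- `[p]`-mapping to define φ.
  have hpow : ∀ a, ε a = 0 → T.toTwisted a ^ p =
      T.toTwisted (a ^ p + if p = 2 then T.τ a a else 0) := by
    intro a ha
    split_ifs with h2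
    · subst h2
      exact T.toTwisted_sq a
    · obtain ⟨n, hn⟩ : ∃ n, p = n + 3 := ⟨p - 3, by
        have := hp.out.two_le
        omega⟩
      rw [add_zero, hn]
      exact T.toTwisted_pow ha n
  have hcomm : ∀ a b, T.toTwisted a * T.toTwisted b - T.toTwisted b * T.toTwisted a =
      T.toTwisted (η ⁅π a, π b⁆) := by
    intro a b
    rw [T.toTwisted_mul, T.toTwisted_mul, ← map_sub, mul_comm b a, add_sub_add_left_eq_sub, hτ,
      hτ, ← map_sub, hσ]
  refine ⟨T.Twisted, inferInstance, inferInstance, T.twistedε,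
    π ∘ₗ T.toTwisted.symm.toLinearMap, T.toTwisted.toLinearMap ∘ₗ η, hπ1, hπη, hεη, ?_, ?_, ?_,
    ?_, ?_⟩
  · intro x y
    refine Eq.trans ?_ (hcomm (η x) (η y)).symm
    rw [hπη, hπη]
    rfl
  · intro x
    refine Eq.trans ?_ (hpow (η x) (hεη x)).symm
    refine congrArg T.toTwisted ?_
    have h := hφ x
    rw [eq_sub_iff_add_eq] at h
    rw [← h, map_add, hηφ, hτ, hπη]
    split_ifs
    · rfl
    · rw [map_zero]; rfl
  · intro a b
    obtain ⟨a, rfl⟩ := T.toTwisted.surjective a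
    obtain ⟨b, rfl⟩ := T.toTwisted.surjective b
    rw [hcomm]
    exact hπη _
  · intro a ha
    obtain ⟨a, rfl⟩ := T.toTwisted.surjective a
    rw [hpow a ha]
    change π (a ^ p + if p = 2 then T.τ a a else 0) = pMap p F (π a)
    have h := hφ (π a)
    rw [eq_sub_iff_add_eq] at h
    rw [← h, map_add, hπφ]
    split_ifs
    · rw [hτ, hπη]
    · rw [map_zero]
  · intro a b
    obtain ⟨a, rfl⟩ := T.toTwisted.surjective a
    obtain ⟨b, rfl⟩ := T.toTwisted.surjective b
    rw [T.toTwisted_mul]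
    change π (a * b + T.τ a b) - (ε a • π b + ε b • π a) ∈ _
    rw [map_add, hτ, hπη, add_sub_right_comm]
    exact add_mem (hπmul' a b) (bracketSpan_le_frattiniSpan (hσZ _ _))

end IsPowerTrivialClassTwo

end ClassTwo

/-! ### Generation modulo brackets and `p`-th powers. -/

open RestrictedEnvelopingAlgebra

namespace IsPowerTrivialClassTwo

variable {p : ℕ} {F : Type*} [Field F] {M : Type*} [LieRing M]
  [LieAlgebra F M] [RestrictedLieAlgebra p F M]

theorem pMap_iterate_add_sub_mem [Fact p.Prime] (hM : IsPowerTrivialClassTwo p F M) (k : ℕ) (x y : M) :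
    (pMap p F)^[k] (x + y) - ((pMap p F)^[k] x + (pMap p F)^[k] y) ∈ bracketSpan F M := by
  induction k with
  | zero => rw [Function.iterate_zero, id, id, id, sub_self]; exact zero_mem _
  | succ k ih =>
    rw [Function.iterate_succ_apply', Function.iterate_succ_apply', Function.iterate_succ_apply',
      hM.pMap_eq_of_sub_mem ih]
    exact hM.pMap_add_sub_mem _ _

theorem pMap_iterate_smul (k : ℕ) (c : F) (x : M) :
    (pMap p F)^[k] (c • x) = c ^ p ^ k • (pMap p F)^[k] x := by
  induction k with
  | zero => simp
  | succ k ih =>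
    rw [Function.iterate_succ_apply', ih, pMap_smul_eq, Function.iterate_succ_apply', ← pow_mul,
      pow_succ]

/-- A restricted subalgebra that spans `M` modulo brackets and `p`-th powers is all of `M`. -/
theorem eq_top_of_sup_frattiniSpan [Fact p.Prime] (hM : IsPowerTrivialClassTwo p F M) {k : ℕ}
    (hk : ∀ x : M, (pMap p F)^[k] x = 0) (K : LieSubalgebra F M)
    (hK : ∀ x ∈ K, pMap p F x ∈ K) (hsup : K.toSubmodule ⊔ frattiniSpan p F M = ⊤) (x : M) :
    x ∈ K := by
  have hdec : ∀ m : M, ∃ a ∈ K, ∃ u ∈ frattiniSpan p F M, a + u = m := fun m =>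
    Submodule.mem_sup.1 (by rw [hsup]; trivial)
  -- `frattiniSpan` is central, so every bracket in M is already a bracket of elements of `K`.
  have hZ : bracketSpan F M ≤ K.toSubmodule := by
    refine Submodule.span_le.2 ?_
    rintro _ ⟨⟨m, n⟩, rfl⟩
    obtain ⟨a, ha, u, hu, rfl⟩ := hdec m
    obtain ⟨b, hb, w, hw, rfl⟩ := hdec n
    change ⁅a + u, b + w⁆ ∈ K
    rw [add_lie, hM.lie_eq_zero_of_mem_frattiniSpan hu, add_zero, lie_add, ← lie_skew a w,
      hM.lie_eq_zero_of_mem_frattiniSpan hw, neg_zero, add_zero]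
    exact K.lie_mem ha hb
  have hKiter : ∀ i, ∀ a ∈ K, (pMap p F)^[i] a ∈ K := by
    intro i a ha
    induction i with
    | zero => exact ha
    | succ i ih => rw [Function.iterate_succ_apply']; exact hK _ ih
  -- The i-th iterate is additive modulo brackets, which lie in `K`, and turns a `p`-th power into a
  -- value of the next iterate. Descent starts at i = k, where the iterate vanishes, and ends at i =
  -- 0.
  have hstep : ∀ i, (∀ m : M, (pMap p F)^[i + 1] m ∈ K) → ∀ m : M, (pMap p F)^[i] m ∈ K := by
    intro i hi m
    have hadd : ∀ a b : M, (pMap p F)^[i] a ∈ K → (pMap p F)^[i] b ∈ K →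
        (pMap p F)^[i] (a + b) ∈ K := fun a b ha hb => by
      have := add_mem (hZ (hM.pMap_iterate_add_sub_mem i a b)) (add_mem ha hb : _ ∈ K.toSubmodule)
      rwa [sub_add_cancel] at this
    obtain ⟨a, ha, u, hu, rfl⟩ := hdec m
    obtain ⟨z, hz, w, hw, rfl⟩ := Submodule.mem_sup.1 hu
    refine hadd _ _ (hKiter i a ha) (hadd _ _ (hKiter i z (hZ hz)) ?_)
    clear hu
    induction hw using Submodule.span_induction with
    | mem z hz => obtain ⟨q, rfl⟩ := hz; exact hi q
    | zero => exact hKiter i 0 K.zero_mem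
    | add a b _ _ ha hb => exact hadd _ _ ha hb
    | smul c a _ ha => rw [pMap_iterate_smul]; exact K.smul_mem _ ha
  have hall : ∀ j, j ≤ k → ∀ m : M, (pMap p F)^[k - j] m ∈ K := by
    intro j
    induction j with
    | zero => intro _ m; rw [Nat.sub_zero, hk]; exact K.zero_mem
    | succ j ih =>
      intro hj
      refine hstep _ ?_
      rw [show k - (j + 1) + 1 = k - j by omega]
      exact ih (by omega)
  simpa using hall k le_rfl x

end IsPowerTrivialClassTwo

/-! ### Passing from maps of enveloping algebras to maps of restricted Lie algebras. -/

section Comparison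

variable {p : ℕ} [hp : Fact p.Prime] {F : Type*} [Field F]

section

variable {L H M : Type*}
  [LieRing L] [LieAlgebra F L] [RestrictedLieAlgebra p F L]
  [LieRing H] [LieAlgebra F H] [RestrictedLieAlgebra p F H]
  [LieRing M] [LieAlgebra F M] [RestrictedLieAlgebra p F M]

/-- A surjection of restricted enveloping algebras that preserves the augmentation induces a
surjection onto `p`-nilpotent quotients that are nilpotent of class at most two with trivial
`[p]`-mapping on the derived algebra. -/
theorem exists_surjective_of_augmented [CharP F p] [PerfectField F] (hM : IsPowerTrivialClassTwo p F M)
    {k : ℕ} (hk : ∀ x : M, (pMap p F)^[k] x = 0) (q : H →ₗ⁅F⁆ M) (hq : Function.Surjective q)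
    (hqp : ∀ x, q (pMap p F x) = pMap p F (q x))
    (ψ : RestrictedEnvelopingAlgebra p F L →ₐ[F] RestrictedEnvelopingAlgebra p F H)
    (hψ : Function.Surjective ψ)
    (hε : ∀ χ : RestrictedEnvelopingAlgebra p F H →ₐ[F] F,
      (∀ x, χ (ι p F H x) = 0) → ∀ x, χ (ψ (ι p F L x)) = 0) :
    ∃ f : L →ₗ⁅F⁆ M, (∀ x, f (pMap p F x) = pMap p F (f x)) ∧ Function.Surjective f := by
  obtain ⟨B, _, _, ε, π, η, hπ1, hπη, hεη, hηlie, hηp, hπlie, hπp, hπmul⟩ :=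
    hM.exists_restricted_retraction k hk
  obtain ⟨g, hg⟩ := exists_lift (p := p) (η ∘ₗ (q : H →ₗ[F] M))
    (fun x y => by
      change η (q ⁅x, y⁆) = η (q x) * η (q y) - η (q y) * η (q x)
      rw [LieHom.map_lie, hηlie])
    (fun x => by
      change η (q (pMap p F x)) = η (q x) ^ p
      rw [hqp, hηp])
  have hg' : ∀ x, g (ι p F H x) = η (q x) := hg
  let G := g.comp ψ
  -- Needed because π respects `p`-th powers only on the augmentation ideal.
  have hεG : ∀ x, ε (G (ι p F L x)) = 0 := hε (ε.comp g) fun x => by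
    rw [AlgHom.comp_apply, hg', hεη]
  let f : L →ₗ⁅F⁆ M :=
    { π ∘ₗ G.toLinearMap ∘ₗ ι p F L with
      map_lie' := fun {x y} => by
        change π (G (ι p F L ⁅x, y⁆)) = ⁅π (G (ι p F L x)), π (G (ι p F L y))⁆
        rw [ι_lie, map_sub, map_mul, map_mul, hπlie] }
  have hf : ∀ x, f x = π (G (ι p F L x)) := fun x => rfl
  have hfp : ∀ x, f (pMap p F x) = pMap p F (f x) := fun x => by
    rw [hf, hf, ι_pMap, map_pow, hπp _ (hεG x)]
  -- Modulo `frattiniSpan`, π ∘ G is a derivation over the augmentation, so its values are spanned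
  -- by those on the generators of u(L).
  have hmem : ∀ a, π (G a) ∈ f.range.toSubmodule ⊔ frattiniSpan p F M := by
    intro a
    induction a using RestrictedEnvelopingAlgebra.induction with
    | algebraMap c =>
      rw [AlgHom.commutes, Algebra.algebraMap_eq_smul_one, map_smul, hπ1, smul_zero]
      exact zero_mem _
    | ι x => exact Submodule.mem_sup_left ⟨x, rfl⟩
    | add a b ha hb => rw [map_add, map_add]; exact add_mem ha hb
    | mul a b ha hb =>
      have h := add_mem (Submodule.mem_sup_right (S := f.range.toSubmodule) (hπmul (G a) (G b)))
        (add_mem (Submodule.smul_mem _ (ε (G a)) hb) (Submodule.smul_mem _ (ε (G b)) ha))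
      rwa [sub_add_cancel, ← map_mul] at h
  refine ⟨f, hfp, fun m => ?_⟩
  refine f.mem_range m |>.1 (hM.eq_top_of_sup_frattiniSpan hk f.range ?_ ?_ m)
  · rintro _ ⟨x, rfl⟩
    exact ⟨pMap p F x, hfp x⟩
  · refine top_le_iff.1 fun m _ => ?_
    obtain ⟨h, rfl⟩ := hq m
    obtain ⟨a, ha⟩ := hψ (ι p F H h)
    have := hmem a
    rwa [AlgHom.comp_apply, ha, hg', hπη] at this

/-- `p`-nilpotence passes through surjections of restricted enveloping algebras that preserve the
augmentation, up to class-two quotients. -/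
theorem pMap_iterate_eq_zero_of_augmented [CharP F p] (hM : IsPowerTrivialClassTwo p F M)
    {k : ℕ} (hk : ∀ x : L, (pMap p F)^[k] x = 0) (q : H →ₗ⁅F⁆ M) (hq : Function.Surjective q)
    (hqp : ∀ x, q (pMap p F x) = pMap p F (q x))
    (ψ : RestrictedEnvelopingAlgebra p F L →ₐ[F] RestrictedEnvelopingAlgebra p F H)
    (hψ : Function.Surjective ψ)
    (ε : RestrictedEnvelopingAlgebra p F H →ₐ[F] F) (hεH : ∀ x, ε (ι p F H x) = 0)
    (hεL : ∀ x, ε (ψ (ι p F L x)) = 0) (m : M) : (pMap p F)^[k + 1] m = 0 := by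
  set Z := bracketSpan F M
  obtain ⟨s, hs⟩ := LinearMap.exists_rightInverse_of_surjective Z.mkQ (Submodule.range_mkQ Z)
  have hs' : ∀ v, Z.mkQ (s v) = v := LinearMap.congr_fun hs
  have hZ : ∀ {x y : M}, x - y ∈ Z ↔ Z.mkQ x = Z.mkQ y := (Submodule.Quotient.eq Z).symm
  let φ : (M ⧸ Z) →+ (M ⧸ Z) :=
    AddMonoidHom.mk' (fun v => Z.mkQ (pMap p F (s v))) fun v w => by
      rw [← map_add, map_add s]
      exact hZ.1 (hM.pMap_add_sub_mem _ _)
  have hφ : ∀ x, φ (Z.mkQ x) = Z.mkQ (pMap p F x) := fun x =>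
    congrArg Z.mkQ (hM.pMap_eq_of_sub_mem (hZ.2 (hs' _)))
  have hφs : ∀ (c : F) v, φ (c • v) = c ^ p • φ v := fun c v => by
    change Z.mkQ (pMap p F (s (c • v))) = c ^ p • Z.mkQ (pMap p F (s v))
    rw [map_smul s, pMap_smul_eq, map_smul]
  obtain ⟨A, _, _, f, hfinj, hfφ, hadd⟩ := exists_injective_frobenius p φ hφs
  obtain ⟨g, hg⟩ := exists_lift (p := p) (f ∘ₗ Z.mkQ ∘ₗ (q : H →ₗ[F] M))
    (fun x y => by
      have : Z.mkQ ⁅q x, q y⁆ = 0 :=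
        (Submodule.Quotient.mk_eq_zero Z).2 (lie_mem_bracketSpan _ _)
      change f (Z.mkQ (q ⁅x, y⁆)) = _
      rw [LieHom.map_lie, this, map_zero, mul_comm, sub_self])
    (fun x => by
      change f (Z.mkQ (q (pMap p F x))) = f (Z.mkQ (q x)) ^ p
      rw [hqp, ← hφ, hfφ])
  have hg' : ∀ x, g (ι p F H x) = f (Z.mkQ (q x)) := hg
  have hadd' : ∀ (j : ℕ) (a b : A), (a + b) ^ p ^ j = a ^ p ^ j + b ^ p ^ j := by
    intro j a b
    induction j with
    | zero => simp
    | succ j ih => rw [pow_succ, pow_mul, ih, hadd, ← pow_mul, ← pow_mul]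
  -- In the commutative algebra `A` the `p^k`-th power is additive, so nilpotence on the generators
  -- from L spreads to the image of the whole augmentation ideal.
  have hnil : ∀ a, (g (ψ a) - algebraMap F A (ε (ψ a))) ^ p ^ k = 0 := by
    intro a
    induction a using RestrictedEnvelopingAlgebra.induction with
    | algebraMap c =>
      rw [AlgHom.commutes, AlgHom.commutes, AlgHom.commutes, Algebra.algebraMap_self_apply,
        sub_self, zero_pow (pow_ne_zero _ hp.out.ne_zero)]
    | ι x =>
      rw [hεL, map_zero, sub_zero, ← map_pow, ← map_pow, ← ι_pMap_iterate, hk, map_zero, map_zero,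
        map_zero]
    | add a b ha hb => rw [map_add, map_add, map_add, map_add, add_sub_add_comm, hadd', ha, hb,
        add_zero]
    | mul a b ha hb =>
      have e : g (ψ (a * b)) - algebraMap F A (ε (ψ (a * b))) =
          (g (ψ a) - algebraMap F A (ε (ψ a))) * g (ψ b) +
          algebraMap F A (ε (ψ a)) * (g (ψ b) - algebraMap F A (ε (ψ b))) := by
        simp only [map_mul]
        ring
      rw [e, hadd', mul_pow, mul_pow, ha, hb, zero_mul, mul_zero, add_zero]
  obtain ⟨h, rfl⟩ := hq m
  obtain ⟨a, ha⟩ := hψ (ι p F H h)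
  have h1 := hnil a
  rw [ha, hεH, map_zero, sub_zero, hg'] at h1
  have hfk : ∀ j v, f (φ^[j] v) = f v ^ p ^ j := by
    intro j v
    induction j with
    | zero => simp
    | succ j ih => rw [Function.iterate_succ_apply', hfφ, ih, ← pow_mul, pow_succ]
  have hφk : ∀ j x, φ^[j] (Z.mkQ x) = Z.mkQ ((pMap p F)^[j] x) := by
    intro j x
    induction j with
    | zero => rfl
    | succ j ih => rw [Function.iterate_succ_apply', ih, hφ, Function.iterate_succ_apply']
  rw [← hfk, hφk, map_eq_zero_iff f hfinj] at h1
  -- Injectivity of `f` only places the k-th iterate in the span of brackets; one more `[p]`-mapping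
  -- kills it.
  rw [Function.iterate_succ_apply']
  exact hM.pMap_eq_zero _ ((Submodule.Quotient.mk_eq_zero Z).1 h1)

end

/-! ### The quotient as the universal class-two quotient with trivial powers on brackets. -/

section Quotient

variable {L M : Type*} [LieRing L] [LieAlgebra F L] [RestrictedLieAlgebra p F L]
  [LieRing M] [LieAlgebra F M] [RestrictedLieAlgebra p F M]

theorem pMap_quotient_mk (x : L) :
    pMap p F (LieSubmodule.Quotient.mk (N := derivedPowAddGammaThree p F L) x) =
      LieSubmodule.Quotient.mk (N := derivedPowAddGammaThree p F L) (pMap p F x) := rfl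

theorem pMap_iterate_quotient_mk (k : ℕ) (x : L) :
    (pMap p F)^[k] (LieSubmodule.Quotient.mk (N := derivedPowAddGammaThree p F L) x) =
      LieSubmodule.Quotient.mk (N := derivedPowAddGammaThree p F L) ((pMap p F)^[k] x) := by
  induction k with
  | zero => rfl
  | succ k ih =>
    rw [Function.iterate_succ_apply', ih, pMap_quotient_mk, Function.iterate_succ_apply']

variable (p F L) in
/-- The quotient map by `L' ^ p + γ_3(L)`, as a homomorphism of Lie algebras. -/
def quotientLieHom : L →ₗ⁅F⁆ (L ⧸ derivedPowAddGammaThree p F L) :=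
  { (LieSubmodule.Quotient.mk' (derivedPowAddGammaThree p F L) : L →ₗ[F] _) with
    map_lie' := fun {_ _} => rfl }

theorem quotientLieHom_surjective : Function.Surjective (quotientLieHom p F L) :=
  LieSubmodule.Quotient.surjective_mk' _

theorem quotientLieHom_pMap (x : L) :
    quotientLieHom p F L (pMap p F x) = pMap p F (quotientLieHom p F L x) := rfl

theorem lie_mem_lieGamma_two (x y : L) : ⁅x, y⁆ ∈ lieGamma F L 2 := by
  change _ ∈ LieModule.lowerCentralSeries F L L (0 + 1)
  rw [LieModule.lowerCentralSeries_succ]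
  exact LieSubmodule.lie_mem_lie (LieSubmodule.mem_top x) trivial

theorem lie_mem_lieGamma_three (x : L) {y : L} (hy : y ∈ lieGamma F L 2) :
    ⁅x, y⁆ ∈ lieGamma F L 3 := by
  change _ ∈ LieModule.lowerCentralSeries F L L (1 + 1)
  rw [LieModule.lowerCentralSeries_succ]
  exact LieSubmodule.lie_mem_lie (LieSubmodule.mem_top x) hy

variable (p F L) in
theorem isPowerTrivialClassTwo_quotient :
    IsPowerTrivialClassTwo p F (L ⧸ derivedPowAddGammaThree p F L) where
  lie_lie := by
    rintro ⟨x⟩ ⟨y⟩ ⟨z⟩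
    refine (LieSubmodule.Quotient.mk_eq_zero' (N := derivedPowAddGammaThree p F L)
      (m := ⁅⁅x, y⁆, z⁆)).2 ?_
    rw [← lie_skew]
    exact neg_mem (Submodule.mem_sup_right
      (lie_mem_lieGamma_three z (lie_mem_lieGamma_two x y)))
  pMap_eq_zero := by
    intro z hz
    have hle : bracketSpan F (L ⧸ derivedPowAddGammaThree p F L) ≤
        (lieGamma F L 2).toSubmodule.map
          (LieSubmodule.Quotient.mk' (derivedPowAddGammaThree p F L) : L →ₗ[F] _) := by
      refine Submodule.span_le.2 ?_
      rintro _ ⟨⟨⟨x⟩, ⟨y⟩⟩, rfl⟩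
      exact ⟨⁅x, y⁆, lie_mem_lieGamma_two x y, rfl⟩
    obtain ⟨z, hz', rfl⟩ := hle hz
    refine (pMap_quotient_mk z).trans (LieSubmodule.Quotient.mk_eq_zero'.2 ?_)
    exact Submodule.mem_sup_left (subset_restrictedSpan _ ⟨z, hz', rfl⟩)

/-- A homomorphism of restricted Lie algebras to a class-two algebra factors through the quotient
by `L' ^ p + γ_3(L)`. -/
theorem exists_factor_quotient (hM : IsPowerTrivialClassTwo p F M) (f : L →ₗ⁅F⁆ M)
    (hf : ∀ x, f (pMap p F x) = pMap p F (f x)) :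
    ∃ g : (L ⧸ derivedPowAddGammaThree p F L) →ₗ⁅F⁆ M,
      (∀ x, g (LieSubmodule.Quotient.mk x) = f x) ∧ ∀ x, g (pMap p F x) = pMap p F (g x) := by
  have h2 : ∀ x ∈ lieGamma F L 2, f x ∈ bracketSpan F M := by
    intro x hx
    change x ∈ LieModule.lowerCentralSeries F L L (0 + 1) at hx
    rw [LieModule.lowerCentralSeries_succ, ← LieSubmodule.mem_toSubmodule,
      LieSubmodule.lieIdeal_oper_eq_linear_span'] at hx
    induction hx using Submodule.span_induction with
    | mem x hx =>
      obtain ⟨a, -, b, -, rfl⟩ := hx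
      rw [LieHom.map_lie]
      exact lie_mem_bracketSpan _ _
    | zero => rw [map_zero]; exact zero_mem _
    | add a b _ _ ha hb => rw [map_add]; exact add_mem ha hb
    | smul c a _ ha => rw [map_smul]; exact Submodule.smul_mem _ c ha
  have h3 : ∀ x ∈ lieGamma F L 3, f x = 0 := by
    intro x hx
    change x ∈ LieModule.lowerCentralSeries F L L (1 + 1) at hx
    rw [LieModule.lowerCentralSeries_succ, ← LieSubmodule.mem_toSubmodule,
      LieSubmodule.lieIdeal_oper_eq_linear_span'] at hx
    induction hx using Submodule.span_induction with
    | mem x hx =>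
      obtain ⟨a, -, b, hb, rfl⟩ := hx
      rw [LieHom.map_lie]
      exact hM.lie_eq_zero_of_mem_bracketSpan' (h2 b hb) _
    | zero => rw [map_zero]
    | add a b _ _ ha hb => rw [map_add, ha, hb, add_zero]
    | smul c a _ ha => rw [map_smul, ha, smul_zero]
  have hp0 : pMap p F (0 : M) = 0 := hM.pMap_eq_zero 0 (zero_mem _)
  have hpow : derivedPow p F L ≤ f.ker.toLieSubalgebra := by
    refine restrictedSpan_le ?_ fun x hx => ?_
    · rintro _ ⟨x, hx, rfl⟩
      change f _ = 0
      rw [hf, hM.pMap_eq_zero _ (h2 x hx)]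
    · change f x = 0 at hx
      change f _ = 0
      rw [hf, hx, hp0]
  have hker : (derivedPowAddGammaThree p F L).toSubmodule ≤ LinearMap.ker (f : L →ₗ[F] M) := by
    refine sup_le (fun x hx => ?_) (fun x hx => ?_)
    · exact hpow hx
    · exact h3 x hx
  refine ⟨{ (derivedPowAddGammaThree p F L).toSubmodule.liftQ (f : L →ₗ[F] M) hker with
    map_lie' := ?_ }, fun x => rfl, ?_⟩
  · rintro ⟨x⟩ ⟨y⟩
    exact f.map_lie x y
  · rintro ⟨x⟩
    exact hf x

end Quotient

end Comparison

/-! ### The isomorphism of the quotients. -/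

theorem mainTheorem10 (p : ℕ) [Fact p.Prime] (F : Type*) [Field F] [CharP F p] [PerfectField F]
    (L : Type*) [LieRing L] [LieAlgebra F L] [RestrictedLieAlgebra p F L]
    [FiniteDimensional F L] (hL : IsPNilpotent p F L)
    (H : Type*) [LieRing H] [LieAlgebra F H] [RestrictedLieAlgebra p F H]
    (e : Nonempty (RestrictedEnvelopingAlgebra p F L ≃ₐ[F] RestrictedEnvelopingAlgebra p F H)) :
    Nonempty (RestrictedLieEquiv p F
      (L ⧸ derivedPowAddGammaThree p F L) (H ⧸ derivedPowAddGammaThree p F H)) := by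
  obtain ⟨e⟩ := e
  obtain ⟨k, -, hk⟩ := hL
  have hp0 : p ≠ 0 := (Fact.out : p.Prime).ne_zero
  have hML := isPowerTrivialClassTwo_quotient p F L
  have hMH := isPowerTrivialClassTwo_quotient p F H
  -- every character of `u(L)` vanishes on `L`
  have hchar : ∀ (χ : RestrictedEnvelopingAlgebra p F L →ₐ[F] F) x, χ (ι p F L x) = 0 := by
    intro χ x
    have h : χ (ι p F L x) ^ p ^ k = 0 := by
      rw [← map_pow, ← ι_pMap_iterate, hk, map_zero, map_zero]
    exact pow_eq_zero_iff (pow_ne_zero _ hp0) |>.1 h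
  obtain ⟨ε, hε⟩ := exists_lift (p := p) (L := H) (0 : H →ₗ[F] F) (fun x y => by simp)
    (fun x => by simp [hp0])
  have hkL : ∀ x : L ⧸ derivedPowAddGammaThree p F L, (pMap p F)^[k] x = 0 := by
    rintro ⟨x⟩
    refine (pMap_iterate_quotient_mk k x).trans ?_
    rw [hk]
    rfl
  have hkH : ∀ x : H ⧸ derivedPowAddGammaThree p F H, (pMap p F)^[k + 1] x = 0 :=
    pMap_iterate_eq_zero_of_augmented hMH hk
      (quotientLieHom p F H)
      quotientLieHom_surjective quotientLieHom_pMap e.toAlgHom e.surjective ε hε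
      (fun x => hchar (ε.comp e.toAlgHom) x)
  obtain ⟨f, hfp, hf⟩ := exists_surjective_of_augmented hMH hkH
    (quotientLieHom p F H)
    quotientLieHom_surjective quotientLieHom_pMap e.toAlgHom e.surjective
    (fun χ _ x => hchar (χ.comp e.toAlgHom) x)
  obtain ⟨g, hgp, hg⟩ := exists_surjective_of_augmented hML hkL
    (quotientLieHom p F L)
    quotientLieHom_surjective quotientLieHom_pMap e.symm.toAlgHom e.symm.surjective
    (fun χ _ x => by
      -- Both characters of u(L) vanish on L, which generates u(L), so they coincide.
      have h : χ = ε.comp e.toAlgHom :=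
        algHom_ext fun y => by rw [hchar, hchar]
      rw [h]
      change ε (e (e.symm (ι p F H x))) = 0
      rw [AlgEquiv.apply_symm_apply]
      exact hε x)
  obtain ⟨f', hf', hfp'⟩ := exists_factor_quotient hMH f hfp
  obtain ⟨g', hg', hgp'⟩ := exists_factor_quotient hML g hgp
  have hfs : Function.Surjective f' := fun y => by
    obtain ⟨x, rfl⟩ := hf y
    exact ⟨_, hf' x⟩
  have hgs : Function.Surjective g' := fun y => by
    obtain ⟨x, rfl⟩ := hg y
    exact ⟨_, hg' x⟩
  have : FiniteDimensional F (L ⧸ derivedPowAddGammaThree p F L) :=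
    inferInstanceAs (FiniteDimensional F (L ⧸ (derivedPowAddGammaThree p F L).toSubmodule))
  -- The composite g' ∘ f' is a surjective endomorphism of the finite-dimensional quotient of L,
  -- hence injective; nothing is needed about the dimension of H.
  have hinj : Function.Injective f' := by
    have h : Function.Injective (g'.toLinearMap ∘ₗ f'.toLinearMap) :=
      LinearMap.injective_iff_surjective.2 (hgs.comp hfs)
    exact fun x y hxy => h (congrArg g' hxy)
  exact ⟨{ LieEquiv.ofBijective f' ⟨hinj, hfs⟩ with map_pMap := hfp' }⟩
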